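/- Let $\lambda$ denote one-dimensional Hausdorff measure in $\mathbb{R}^2$ (normalized so that a unit segment has measure $1$). For $r>0$, a set $S\subset\mathbb{R}^2$ satisfies the $r$-rolling condition if for every $x\in\partial S$ there is an open ball $B$ of radius $r$ with $x\in\partial B$ and $B\cap S=\emptyset$. For $\alpha>0$ and a finite set $\mathcal{X}\subset\mathbb{R}^2$, two distinct points $x,y\in\mathcal{X}$ form an $\alpha$-edge if there is an open ball $B$ of radius $\alpha$ with $x,y\in\partial B$ and $B\cap\mathcal{X}=\emptyset$; the $\alpha$-shape $C_\alpha(\mathcal{X})$ is the union of the segments $[x,y]$ over all $\alpha$-edges. Let $0<\alpha<r$. There is a constant $t_0>0$ depending only on $(\alpha,r)$ and, for every $d$, a constant $A>0$ depending only on $(\alpha,r,d)$ such that the following holds for every nonempty compact set $S\subset\mathbb{R}^2$ of diameter $d$ such that both $S$ and $S^{\mathsf c}$ satisfy the $r$-rolling condition. First, $0<\lambda(\partial S)<\infty$. Second, if $n\ge 1$, $X_1,\dots,X_n$ are independent and uniformly distributed on $S$, and $C_\alpha=C_\alpha(\{X_1,\dots,X_n\})$, then for all $0\le t\le t_0$,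 \[ \mathbb{P}\left(\left|\frac{\lambda(C_\alpha)}{\lambda(\partial S)}-1\right|>t\right)\le A\,n^2\exp\left(-\frac{n\,t^{3/2}}{A}\right). \] Third, if $X_1,X_2,\dots$ is an infinite sequence of independent random points uniformly distributed on $S$ and $\varepsilon_n=(3A\log(n)/n)^{2/3}$, then with probability one, for all sufficiently large $n$, \[ (1-\varepsilon_n)\,\lambda(\partial S)\le\lambda\bigl(C_\alpha(\{X_1,\dots,X_n\})\bigr)\le(1+\varepsilon_n)\,\lambda(\partial S). \] -/

import Mathlib

open MeasureTheory ProbabilityTheory Set Filter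
open scoped Topology ENNReal

universe u

/-- The Euclidean plane. -/
abbrev Plane : Type := EuclideanSpace ℝ (Fin 2)

/-- The `r`-rolling condition for `S`: through every boundary point of `S` passes the boundary
circle of an open ball of radius `r` that does not meet `S`. -/
def RollingCondition (r : ℝ) (S : Set Plane) : Prop :=
  ∀ x ∈ frontier S, ∃ c : Plane, x ∈ Metric.sphere c r ∧ Metric.ball c r ∩ S = ∅

/-- Two distinct points `x`, `y` of the point set `𝒳` form an `α`-edge if they both lie on the
boundary circle of an open ball of radius `α` that contains no point of `𝒳`. -/
def IsAlphaEdge (α : ℝ) (𝒳 : Set Plane) (x y : Plane) : Prop :=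
  x ∈ 𝒳 ∧ y ∈ 𝒳 ∧ x ≠ y ∧
    ∃ c : Plane, x ∈ Metric.sphere c α ∧ y ∈ Metric.sphere c α ∧ Metric.ball c α ∩ 𝒳 = ∅

/-- The `α`-shape of the point set `𝒳`, as a polygonal line: the union of the segments that join
the endpoints of its `α`-edges. -/
def alphaShape (α : ℝ) (𝒳 : Set Plane) : Set Plane :=
  {z | ∃ x y : Plane, IsAlphaEdge α 𝒳 x y ∧ z ∈ segment ℝ x y}

/-- The length of a subset of the plane: its one-dimensional Hausdorff measure, as an extended
nonnegative real. In Mathlib's normalization a segment of length `1` has measure `1`. -/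
noncomputable def hausdorffLength (C : Set Plane) : ℝ≥0∞ := Measure.hausdorffMeasure 1 C

/-- The random variables `X i` are independent and each of them is uniformly distributed on `S`
(with respect to Lebesgue measure). -/
def IsUniformSample {Ω ι : Type*} [MeasurableSpace Ω] (P : Measure Ω) (S : Set Plane)
    (X : ι → Ω → Plane) : Prop :=
  (∀ i, Measurable (X i)) ∧ (∀ i, pdf.IsUniform (X i) S P volume) ∧ iIndepFun X P

open scoped RealInnerProductSpace

/-! The heart of the proof is deterministic. Fix a small `m` and scales `κ` of order `m` and `h` of
order `m ^ 2`. Call a finite sample hitting if every ball of radius `α` with centre within `α - h`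
of `S` contains a sample point. For a hitting sample in general position, the two lengths differ by
a factor within `300 * m ^ 2` of `1` (`abs_length_ratio_sub_one_le`).

Geometry of the frontier: the outer and inner rolling balls at a frontier point are disjoint, hence
tangent to each other. They give a normal that is Lipschitz in the point, and a nearest-point
projection that is almost a contraction near the frontier.

Lower bound on the shape: slide an `α`-ball resting on the sample across the window `[-κ, κ]` above
a frontier point `p`. At the left end it touches points on the left, at the right end points on the
right, so by connectedness some position touches both sides. This gives an edge that crosses the
normal line at `p` within `O(m ^ 2)` (`exists_crossing_edge`). Projecting these crossings covers the
frontier up to finitely many points.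

Upper bound: the empty ball of an edge can enter `S` only to depth less than `h`. Hence the edge
lies within `O(m ^ 2)` of the frontier and is tilted by `O(m)` (`edge_estimate`). By Pythagoras the
tilt costs only `O(m ^ 2)` in length. Two edges over the same normal line have the same empty ball
(`center_eq_of_crossing`), so in general position the projections of different edges overlap in a
null set.

Probability: a ball that must be hit contains a part of `S` of area of order `h * κ`, that is `m ^
3`, and a net of order `h⁻²` centres suffices. With `t = 300 * m ^ 2` the union bound is of order
`t⁻² * exp (-c * n * t ^ (3 / 2))`. The factor `t⁻²` is traded for `n ^ 2`, and Borel–Cantelli gives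
the almost sure rate. -/

/-- A preconnected set that meets both `S` and its complement meets the frontier of `S`. -/
theorem IsPreconnected.exists_mem_frontier {X : Type*} [TopologicalSpace X] {A S : Set X}
    (hA : IsPreconnected A) {x y : X} (hx : x ∈ A) (hxS : x ∈ S) (hy : y ∈ A) (hyS : y ∉ S) :
    ∃ z ∈ A, z ∈ frontier S := by
  by_contra! h
  have hcov : A ⊆ interior S ∪ interior Sᶜ := by
    intro z hz
    have := h z hz
    rw [frontier_eq_closure_inter_closure, mem_inter_iff, not_and_or] at this
    rw [interior_compl, ← compl_compl (interior S), ← closure_compl]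
    tauto
  have hdisj : Disjoint (interior S) (interior Sᶜ) :=
    (disjoint_compl_right (a := S)).mono interior_subset interior_subset
  rcases hA.subset_or_subset isOpen_interior isOpen_interior hdisj hcov with h1 | h1
  · exact hyS (interior_subset (h1 hy))
  · exact interior_subset (h1 hx) hxS

/-! ### Coordinates in an orthonormal frame -/

namespace Plane

/-- Rotation by a right angle. -/
noncomputable def rot (v : Plane) : Plane := !₂[-v 1, v 0]

theorem inner_coord (a b : Plane) : ⟪a, b⟫ = a 0 * b 0 + a 1 * b 1 := by
  simp [PiLp.inner_apply, Fin.sum_univ_two, mul_comm]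

theorem norm_sq_coord (a : Plane) : ‖a‖ ^ 2 = a 0 ^ 2 + a 1 ^ 2 := by
  rw [← real_inner_self_eq_norm_sq, inner_coord]; ring

@[simp] theorem rot_apply_zero (v : Plane) : rot v 0 = -v 1 := rfl
@[simp] theorem rot_apply_one (v : Plane) : rot v 1 = v 0 := rfl

theorem norm_rot (v : Plane) : ‖rot v‖ = ‖v‖ := by
  rw [← sq_eq_sq₀ (norm_nonneg _) (norm_nonneg _), norm_sq_coord, norm_sq_coord]
  simp; ring

theorem inner_rot_self (v : Plane) : ⟪v, rot v⟫ = 0 := by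
  rw [inner_coord]; simp; ring

theorem inner_rot_self' (v : Plane) : ⟪rot v, v⟫ = 0 := by
  rw [inner_coord]; simp; ring

theorem inner_eq_add {n : Plane} (hn : ‖n‖ = 1) (a b : Plane) :
    ⟪a, b⟫ = ⟪a, rot n⟫ * ⟪b, rot n⟫ + ⟪a, n⟫ * ⟪b, n⟫ := by
  have h : n 0 ^ 2 + n 1 ^ 2 = 1 := by rw [← norm_sq_coord, hn]; norm_num
  simp only [inner_coord, rot_apply_zero, rot_apply_one]
  linear_combination (-(a 0 * b 0 + a 1 * b 1)) * h

theorem norm_sq_eq_add {n : Plane} (hn : ‖n‖ = 1) (a : Plane) :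
    ‖a‖ ^ 2 = ⟪a, rot n⟫ ^ 2 + ⟪a, n⟫ ^ 2 := by
  rw [← real_inner_self_eq_norm_sq, inner_eq_add hn]; ring

theorem eq_smul_add_smul {n : Plane} (hn : ‖n‖ = 1) (a : Plane) :
    a = ⟪a, rot n⟫ • rot n + ⟪a, n⟫ • n := by
  have h : n 0 ^ 2 + n 1 ^ 2 = 1 := by rw [← norm_sq_coord, hn]; norm_num
  ext i
  fin_cases i
  · simp [inner_coord]
    linear_combination (-(a 0)) * h
  · simp [inner_coord]
    linear_combination (-(a 1)) * h

/-- The point with tangential coordinate `u` and normal coordinate `w` in the frame at `p` with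
normal `n`. -/
noncomputable def framePoint (p n : Plane) (u w : ℝ) : Plane := p + u • rot n + w • n

theorem inner_framePoint_sub {p n : Plane} (hn : ‖n‖ = 1) (u w : ℝ) :
    ⟪framePoint p n u w - p, n⟫ = w := by
  have : framePoint p n u w - p = u • rot n + w • n := by simp [framePoint, add_assoc]
  rw [this, inner_add_left, inner_smul_left, inner_smul_left, inner_rot_self',
    real_inner_self_eq_norm_sq, hn]
  simp

theorem inner_framePoint_sub_rot {p n : Plane} (hn : ‖n‖ = 1) (u w : ℝ) :
    ⟪framePoint p n u w - p, rot n⟫ = u := by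
  have : framePoint p n u w - p = u • rot n + w • n := by simp [framePoint, add_assoc]
  rw [this, inner_add_left, inner_smul_left, inner_smul_left, inner_rot_self,
    real_inner_self_eq_norm_sq, norm_rot, hn]
  simp

theorem norm_sub_framePoint_sq {p n : Plane} (hn : ‖n‖ = 1) (q : Plane) (u w : ℝ) :
    ‖q - framePoint p n u w‖ ^ 2 = (⟪q - p, rot n⟫ - u) ^ 2 + (⟪q - p, n⟫ - w) ^ 2 := by
  rw [norm_sq_eq_add hn]
  have : q - framePoint p n u w = (q - p) - (framePoint p n u w - p) := by abel
  rw [this, inner_sub_left (q - p), inner_sub_left (q - p), inner_framePoint_sub hn,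
    inner_framePoint_sub_rot hn]

theorem eq_framePoint {n : Plane} (hn : ‖n‖ = 1) (p q : Plane) :
    q = framePoint p n ⟪q - p, rot n⟫ ⟪q - p, n⟫ := by
  have := eq_smul_add_smul hn (q - p)
  rw [framePoint, add_assoc, ← this]; abel

@[fun_prop]
theorem continuous_framePoint (p n : Plane) :
    Continuous fun x : ℝ × ℝ => framePoint p n x.1 x.2 := by
  unfold framePoint; fun_prop

end Plane

/-! ### Rolling normals and the nearest-point projection -/

open Plane

/-- The unit vector `n` is an outward normal of `S` at `p`, with balls of radius `r` touching on
both sides. -/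
structure IsRollingNormal (r : ℝ) (S : Set Plane) (p n : Plane) : Prop where
  norm_eq : ‖n‖ = 1
  inner_le : ∀ q ∈ closure S, 2 * r * ⟪q - p, n⟫ ≤ ‖q - p‖ ^ 2
  le_inner : ∀ q ∈ closure Sᶜ, -‖q - p‖ ^ 2 ≤ 2 * r * ⟪q - p, n⟫

theorem le_dist_of_ball_inter_eq_empty {S : Set Plane} {c q : Plane} {r : ℝ}
    (h : Metric.ball c r ∩ S = ∅) (hq : q ∈ closure S) : r ≤ ‖q - c‖ := by
  by_contra! hlt
  have : (Metric.ball c r ∩ S).Nonempty :=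
    mem_closure_iff.1 hq _ Metric.isOpen_ball (by rwa [Metric.mem_ball, dist_eq_norm])
  exact this.ne_empty h

theorem add_le_norm_of_balls {S : Set Plane} {a b : Plane} {r s : ℝ} (hr : 0 < r) (hs : 0 < s)
    (ha : Metric.ball a r ∩ S = ∅) (hb : Metric.ball b s ∩ Sᶜ = ∅) : r + s ≤ ‖a - b‖ := by
  have hdisj : Disjoint (Metric.ball a r) (Metric.ball b s) := by
    rw [Set.disjoint_left]
    intro z hza hzb
    by_cases hz : z ∈ S
    · exact (ha ▸ (⟨hza, hz⟩ : z ∈ Metric.ball a r ∩ S) : z ∈ (∅ : Set Plane))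
    · exact (hb ▸ (⟨hzb, hz⟩ : z ∈ Metric.ball b s ∩ Sᶜ) : z ∈ (∅ : Set Plane))
  rw [← dist_eq_norm]
  by_contra! hlt
  have := (disjoint_ball_ball_iff hr hs).1 hdisj
  linarith

theorem eq_of_two_le_norm_add {a b : Plane} (ha : ‖a‖ = 1) (hb : ‖b‖ = 1) (h : 2 ≤ ‖a + b‖) :
    a = b := by
  have := parallelogram_law_with_norm ℝ a b
  rw [ha, hb] at this
  have h2 : ‖a - b‖ = 0 := by nlinarith [norm_nonneg (a - b), norm_nonneg (a + b)]
  exact sub_eq_zero.1 (norm_eq_zero.1 h2)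

/-- The ball outside `S` and the ball inside `S` through `p` are disjoint, so their centres are at
least `2 * r` apart, while each centre is at distance `r` from `p`. Equality in the triangle
inequality puts the centres on opposite sides of `p`. -/
theorem exists_isRollingNormal {r : ℝ} (hr : 0 < r) {S : Set Plane}
    (h1 : RollingCondition r S) (h2 : RollingCondition r Sᶜ) {p : Plane} (hp : p ∈ frontier S) :
    ∃ n, IsRollingNormal r S p n := by
  obtain ⟨a, ha, haS⟩ := h1 p hp
  obtain ⟨b, hb, hbS⟩ := h2 p (by rwa [frontier_compl])
  rw [Metric.mem_sphere, dist_eq_norm] at ha hb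
  have hle := add_le_norm_of_balls hr hr haS hbS
  have hn1 : ‖r⁻¹ • (a - p)‖ = 1 := by
    rw [norm_smul, norm_inv, Real.norm_of_nonneg hr.le, norm_sub_rev, ha, inv_mul_cancel₀ hr.ne']
  have hn2 : ‖r⁻¹ • (p - b)‖ = 1 := by
    rw [norm_smul, norm_inv, Real.norm_of_nonneg hr.le, hb, inv_mul_cancel₀ hr.ne']
  have heq : r⁻¹ • (a - p) = r⁻¹ • (p - b) := by
    refine eq_of_two_le_norm_add hn1 hn2 ?_
    rw [← smul_add, sub_add_sub_cancel, norm_smul, norm_inv, Real.norm_of_nonneg hr.le,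
      inv_mul_eq_div, le_div_iff₀ hr]
    linarith
  set n := r⁻¹ • (a - p) with hn
  have ha' : a = p + r • n := by rw [hn, smul_inv_smul₀ hr.ne']; abel
  have hb' : b = p - r • n := by rw [heq, smul_inv_smul₀ hr.ne']; abel
  refine ⟨n, hn1, fun q hq => ?_, fun q hq => ?_⟩
  · have h := le_dist_of_ball_inter_eq_empty haS hq
    have h3 : q - a = (q - p) - r • n := by rw [ha']; abel
    have h4 := norm_sub_sq_real (q - p) (r • n)
    rw [inner_smul_right, norm_smul, hn1, Real.norm_of_nonneg hr.le, ← h3] at h4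
    nlinarith
  · have h := le_dist_of_ball_inter_eq_empty hbS hq
    have h3 : q - b = (q - p) + r • n := by rw [hb']; abel
    have h4 := norm_add_sq_real (q - p) (r • n)
    rw [inner_smul_right, norm_smul, hn1, Real.norm_of_nonneg hr.le, ← h3] at h4
    nlinarith

namespace IsRollingNormal

variable {r : ℝ} {S : Set Plane} {p n p' n' : Plane}

theorem compl (h : IsRollingNormal r S p n) : IsRollingNormal r Sᶜ p (-n) where
  norm_eq := by rw [norm_neg, h.norm_eq]
  inner_le q hq := by have := h.le_inner q hq; rw [inner_neg_right]; linarith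
  le_inner q hq := by
    rw [compl_compl] at hq
    have := h.inner_le q hq; rw [inner_neg_right]; linarith

theorem ball_inter_eq_empty (hr : 0 < r) (h : IsRollingNormal r S p n) :
    Metric.ball (p + r • n) r ∩ S = ∅ := by
  rw [Set.eq_empty_iff_forall_notMem]
  rintro q ⟨hq, hqS⟩
  rw [Metric.mem_ball, dist_eq_norm] at hq
  have h3 : q - (p + r • n) = (q - p) - r • n := by abel
  have h4 := norm_sub_sq_real (q - p) (r • n)
  rw [inner_smul_right, norm_smul, h.norm_eq, Real.norm_of_nonneg hr.le, ← h3] at h4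
  have := h.inner_le q (subset_closure hqS)
  nlinarith [norm_nonneg (q - (p + r • n))]

theorem ball_inter_compl_eq_empty (hr : 0 < r) (h : IsRollingNormal r S p n) :
    Metric.ball (p - r • n) r ∩ Sᶜ = ∅ := by
  have := h.compl.ball_inter_eq_empty hr
  rwa [smul_neg, ← sub_eq_add_neg] at this

theorem abs_inner_le (h : IsRollingNormal r S p n) {q : Plane} (hr : 0 < r)
    (hq : q ∈ frontier S) :
    |⟪q - p, n⟫| ≤ ‖q - p‖ ^ 2 / (2 * r) := by
  rw [frontier_eq_closure_inter_closure] at hq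
  have h1 := h.inner_le q hq.1
  have h2 := h.le_inner q hq.2
  rw [abs_le, ← neg_div, div_le_iff₀ (by positivity), le_div_iff₀ (by positivity)]
  constructor <;> linarith

/-- The normal field is Lipschitz. -/
theorem norm_sub_le (hr : 0 < r) (h : IsRollingNormal r S p n) (h' : IsRollingNormal r S p' n') :
    ‖n - n'‖ ≤ ‖p - p'‖ / r := by
  -- The outer ball at each point is disjoint from the inner ball at the other. This bounds both `r
  -- • (n + n') ± (p - p')` from below, and the parallelogram law adds the two bounds.
  have h1 := add_le_norm_of_balls hr hr (h.ball_inter_eq_empty hr) (h'.ball_inter_compl_eq_empty hr)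
  have h2 := add_le_norm_of_balls hr hr (h'.ball_inter_eq_empty hr) (h.ball_inter_compl_eq_empty hr)
  have e1 : p + r • n - (p' - r • n') = r • (n + n') + (p - p') := by rw [smul_add]; abel
  have e2 : p' + r • n' - (p - r • n) = r • (n + n') - (p - p') := by rw [smul_add]; abel
  rw [e1] at h1
  rw [e2] at h2
  have h3 := parallelogram_law_with_norm ℝ (r • (n + n')) (p - p')
  have h4 := parallelogram_law_with_norm ℝ n n'
  rw [norm_smul, Real.norm_of_nonneg hr.le] at h3
  rw [h.norm_eq, h'.norm_eq] at h4
  have h5 : (r * ‖n - n'‖) ^ 2 ≤ ‖p - p'‖ ^ 2 := by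
    have : (r * ‖n - n'‖) ^ 2 = r ^ 2 * (4 - ‖n + n'‖ * ‖n + n'‖) := by
      rw [mul_pow]; congr 1; nlinarith
    nlinarith
  rw [le_div_iff₀ hr, mul_comm]
  exact (sq_le_sq₀ (by positivity) (norm_nonneg _)).1 h5

/-- The nearest-point projection onto the frontier is Lipschitz near the frontier. -/
theorem norm_sub_mul_le (hr : 0 < r) (h : IsRollingNormal r S p n) (h' : IsRollingNormal r S p' n')
    (hp : p ∈ frontier S) (hp' : p' ∈ frontier S) {s s' η : ℝ} (hs : |s| ≤ η) (hs' : |s'| ≤ η) :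
    ‖p - p'‖ * (1 - η / r) ≤ ‖(p + s • n) - (p' + s' • n')‖ := by
  rcases eq_or_ne p p' with rfl | hne
  · simp
  have hpos : 0 < ‖p - p'‖ := norm_pos_iff.2 (sub_ne_zero.2 hne)
  have h1 := abs_inner_le h' hr hp
  have h2 := abs_inner_le h hr hp'
  have h2' : ⟪p' - p, n⟫ = -⟪p - p', n⟫ := by rw [← inner_neg_left, neg_sub]
  rw [h2', abs_neg, norm_sub_rev] at h2
  -- Testing against `p - p'` suffices: the normal displacements contribute only through inner
  -- products that are quadratic in `‖p - p'‖`.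
  have e : ⟪(p + s • n) - (p' + s' • n'), p - p'⟫
      = ‖p - p'‖ ^ 2 + s * ⟪p - p', n⟫ - s' * ⟪p - p', n'⟫ := by
    have : (p + s • n) - (p' + s' • n') = (p - p') + s • n - s' • n' := by abel
    rw [this, inner_sub_left, inner_add_left, inner_smul_left, inner_smul_left,
      real_inner_self_eq_norm_sq, real_inner_comm n, real_inner_comm n']
    simp
  have hcs := real_inner_le_norm ((p + s • n) - (p' + s' • n')) (p - p')
  rw [e] at hcs
  have hb1 : |s * ⟪p - p', n⟫| ≤ η * (‖p - p'‖ ^ 2 / (2 * r)) := by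
    rw [abs_mul]; gcongr; exact (abs_nonneg s).trans hs
  have hb2 : |s' * ⟪p - p', n'⟫| ≤ η * (‖p - p'‖ ^ 2 / (2 * r)) := by
    rw [abs_mul]; gcongr; exact (abs_nonneg s).trans hs
  have e2 : η * (‖p - p'‖ ^ 2 / (2 * r)) = (η / r) * ‖p - p'‖ ^ 2 / 2 := by field_simp
  rw [e2] at hb1 hb2
  have := (abs_le.1 hb1).1
  have := (abs_le.1 hb2).2
  have : ‖p - p'‖ * (‖p - p'‖ * (1 - η / r)) ≤
      ‖p - p'‖ * ‖(p + s • n) - (p' + s' • n')‖ := by nlinarith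
  exact le_of_mul_le_mul_left this hpos

/-- A point whose distance `s` to `p` is realised by a ball outside `S` lies on the outer normal. -/
theorem eq_add_smul_of_ball_inter (hr : 0 < r) (h : IsRollingNormal r S p n) {z : Plane} {s : ℝ}
    (hs : 0 ≤ s) (hz : ‖z - p‖ = s) (hball : Metric.ball z s ∩ S = ∅) : z = p + s • n := by
  rcases hs.eq_or_lt with rfl | hs
  · simpa [sub_eq_zero] using hz
  -- The ball at `z` and the inner rolling ball are disjoint and both pass through `p`, so their
  -- centres are aligned with `p`.
  have h1 := add_le_norm_of_balls hs hr hball (h.ball_inter_compl_eq_empty hr)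
  have e : z - (p - r • n) = (z - p) + r • n := by abel
  have h2 := norm_add_sq_real (z - p) (r • n)
  rw [inner_smul_right, norm_smul, h.norm_eq, Real.norm_of_nonneg hr.le, ← e, hz] at h2
  have h3 : s ≤ ⟪z - p, n⟫ := by
    have : (s + r) ^ 2 ≤ ‖z - (p - r • n)‖ ^ 2 := by gcongr
    nlinarith
  have h4 : ‖(z - p) - s • n‖ ^ 2 ≤ 0 := by
    rw [norm_sub_sq_real, inner_smul_right, norm_smul, h.norm_eq, Real.norm_of_nonneg hs.le, hz]
    nlinarith
  have h5 : ‖(z - p) - s • n‖ = 0 := by nlinarith [norm_nonneg ((z - p) - s • n)]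
  have h6 := sub_eq_zero.1 (norm_eq_zero.1 h5)
  rw [← h6]; abel

/-- A point lies on the normal line through any of its nearest points on the frontier. -/
theorem exists_eq_add_smul (hr : 0 < r) (h : IsRollingNormal r S p n) {z : Plane}
    (hz : ‖z - p‖ = Metric.infDist z (frontier S)) :
    ∃ s : ℝ, |s| = ‖z - p‖ ∧ z = p + s • n := by
  -- This ball misses the frontier, so by connectedness it lies entirely in `S` or entirely in its
  -- complement.
  have hpre : IsPreconnected (Metric.ball z ‖z - p‖) := (convex_ball _ _).isPreconnected
  have hfr : ∀ w ∈ Metric.ball z ‖z - p‖, w ∉ frontier S := by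
    intro w hw hwS
    have := Metric.infDist_le_dist_of_mem (x := z) hwS
    rw [Metric.mem_ball, dist_comm] at hw
    linarith
  by_cases hempty : Metric.ball z ‖z - p‖ ∩ S = ∅
  · exact ⟨_, abs_norm _, h.eq_add_smul_of_ball_inter hr (norm_nonneg _) rfl hempty⟩
  · obtain ⟨w, hw, hwS⟩ := nonempty_iff_ne_empty.2 hempty
    have hempty' : Metric.ball z ‖z - p‖ ∩ Sᶜ = ∅ := by
      rw [Set.eq_empty_iff_forall_notMem]
      rintro w' ⟨hw', hw'S⟩
      obtain ⟨y, hy, hyS⟩ := hpre.exists_mem_frontier hw hwS hw' hw'S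
      exact hfr y hy hyS
    refine ⟨-‖z - p‖, by simp, ?_⟩
    have := h.compl.eq_add_smul_of_ball_inter hr (norm_nonneg _) rfl hempty'
    rwa [smul_neg, ← neg_smul] at this

end IsRollingNormal
-- Length scales
/-- The length scales of the comparison between the `α`-shape and the frontier: `κ` is the tangential
scale, `h` the depth of the balls that have to meet the sample, `m` the relative tangential scale,
and `M = r / (r - α)`. -/
structure RollingScale (r α m M κ h : ℝ) : Prop where
  pos : 0 < α
  lt : α < r
  ratio : M * (r - α) = r
  m_pos : 0 < m
  m_le : 1000 * m ≤ 1
  width : M * κ = m * α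
  depth : 4 * α * M * h = κ ^ 2

namespace RollingScale

variable {r α m M κ h : ℝ}

theorem r_pos (H : RollingScale r α m M κ h) : 0 < r := H.pos.trans H.lt

theorem M_pos (H : RollingScale r α m M κ h) : 0 < M := by
  have h1 := H.ratio
  have h2 := H.lt
  have h3 := H.r_pos
  by_contra! hM
  nlinarith

theorem one_le (H : RollingScale r α m M κ h) : 1 ≤ M := by
  have h1 := H.ratio
  have h2 := H.lt
  have h3 := H.pos
  by_contra! hM
  nlinarith

theorem κ_pos (H : RollingScale r α m M κ h) : 0 < κ := by
  have h1 := H.width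
  have h2 := mul_pos H.m_pos H.pos
  have h3 := H.M_pos
  by_contra! hM
  nlinarith

theorem h_pos (H : RollingScale r α m M κ h) : 0 < h := by
  have h1 := H.depth
  have h2 := mul_pos H.pos H.M_pos
  have h3 := pow_pos H.κ_pos 2
  by_contra! hM
  nlinarith

theorem κ_le (H : RollingScale r α m M κ h) : κ ≤ m * α := by
  have h1 := H.width
  have h2 := H.one_le
  have h3 := H.κ_pos
  nlinarith

theorem h_le (H : RollingScale r α m M κ h) : 4 * h ≤ m ^ 2 * α := by
  have h1 := H.depth
  have h2 := H.one_le
  have h3 := H.κ_pos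
  have h4 := H.κ_le
  have h5 := H.pos
  have h6 := H.h_pos
  have : 4 * α * h ≤ α * (m ^ 2 * α) := by
    calc 4 * α * h ≤ 4 * α * M * h := by nlinarith [mul_pos h5 h6]
      _ = κ ^ 2 := h1
      _ ≤ (m * α) ^ 2 := by gcongr
      _ = _ := by ring
  nlinarith

end RollingScale

/-! ### Points touched by a ball near the frontier -/

section LocalEstimates

variable {r α m M κ h : ℝ} {S : Set Plane} {p n : Plane}

/-- Since `r - α = r / M`, a centre height `ψ` not much above `α` keeps `r - ψ` at least `3 / 4` of
`r / M`. This is the coercivity behind the touching estimates, and the place where `α < r` is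
quantified. -/
theorem RollingScale.ratio_mul_le (H : RollingScale r α m M κ h) {ψ : ℝ}
    (hψ : α * (ψ - α) ≤ M * κ ^ 2) : 3 * r ≤ 4 * M * (r - ψ) := by
  have hr := H.r_pos
  have hM := H.M_pos
  have hmα := mul_pos H.m_pos H.pos
  have e : M * (r - ψ) = r - M * (ψ - α) := by linear_combination H.ratio
  have h1 : m * α ≤ α / 2 := by nlinarith [H.pos, H.m_le]
  have h3 : α * (M * (ψ - α)) ≤ α * (r / 4) := by
    calc α * (M * (ψ - α)) = M * (α * (ψ - α)) := by ring
      _ ≤ M * (M * κ ^ 2) := by gcongr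
      _ = (M * κ) ^ 2 := by ring
      _ = (m * α) ^ 2 := by rw [H.width]
      _ ≤ (α / 2) ^ 2 := by gcongr
      _ = α * (α / 4) := by ring
      _ ≤ α * (r / 4) := by have := H.lt; have := H.pos; gcongr
  have h4 : M * (ψ - α) ≤ r / 4 := le_of_mul_le_mul_left h3 H.pos
  linarith

theorem RollingScale.half_le (H : RollingScale r α m M κ h) {ψ : ℝ}
    (hψ : α * (α - ψ) ≤ κ ^ 2) : α / 2 ≤ ψ := by
  have hα := H.pos
  have hκα : κ ≤ α / 2 := by nlinarith [H.κ_le, H.m_le]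
  have h1 : κ ^ 2 ≤ (α / 2) ^ 2 := by gcongr; exact H.κ_pos.le
  have h2 : α * (α - ψ) ≤ α * (α / 2) := by nlinarith
  linarith [le_of_mul_le_mul_left h2 hα]

/-- In the frame at `p`, the ball has centre `(u, ψ)` and touches `(v₁, v₂)`, which lies outside the
outer rolling ball. Eliminating `v₂` from the circle equation leaves `(r - ψ) * N ^ 2 ≤ r * (2 * κ ^
2 + 2 * κ * N)`, so `N` is at most `4 * M * κ = 4 * m * α`. -/
theorem touching_norm_le (H : RollingScale r α m M κ h) {u ψ v₁ v₂ N : ℝ}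
    (hu : |u| ≤ κ) (hψ₁ : α * (α - ψ) ≤ κ ^ 2) (hψ₂ : α * (ψ - α) ≤ M * κ ^ 2) (hN : 0 ≤ N)
    (hv : N ^ 2 = v₁ ^ 2 + v₂ ^ 2) (hout : 2 * r * v₂ ≤ N ^ 2)
    (htouch : (v₁ - u) ^ 2 + (v₂ - ψ) ^ 2 = α ^ 2) : N ≤ 4 * m * α := by
  have hr := H.r_pos
  have hM := H.M_pos
  have hM1 := H.one_le
  have hκ := H.κ_pos
  have hψpos : 0 ≤ ψ := (half_pos H.pos).le.trans (H.half_le hψ₁)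
  have h1 : α ^ 2 - ψ ^ 2 ≤ 2 * κ ^ 2 := by nlinarith only [sq_nonneg (α - ψ), hψ₁]
  have hv1 : |v₁| ≤ N := abs_le.2 (abs_le_of_sq_le_sq' (by nlinarith only [sq_nonneg v₂, hv]) hN)
  have huv : |u * v₁| ≤ κ * N := by rw [abs_mul]; gcongr
  have huv' := (abs_le.1 huv).2
  have h2 := H.ratio_mul_le hψ₂
  have h5 : (r - ψ) * N ^ 2 ≤ r * (2 * κ ^ 2 + 2 * κ * N) := by
    have h6 : ψ * (2 * r * v₂) ≤ ψ * N ^ 2 := mul_le_mul_of_nonneg_left hout hψpos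
    have h7 : N ^ 2 - 2 * (u * v₁) - 2 * ψ * v₂ + u ^ 2 + ψ ^ 2 = α ^ 2 := by rw [hv, ← htouch]; ring
    have h8 : N ^ 2 - 2 * ψ * v₂ ≤ 2 * κ ^ 2 + 2 * κ * N := by
      nlinarith only [sq_nonneg u, h7, h1, huv']
    have := mul_le_mul_of_nonneg_left h8 hr.le
    nlinarith only [this, h6]
  have h6 : 3 * N ^ 2 ≤ 8 * M * κ ^ 2 + 8 * M * κ * N := by
    have h7 : 3 * r * N ^ 2 ≤ 4 * M * (r * (2 * κ ^ 2 + 2 * κ * N)) := by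
      calc 3 * r * N ^ 2 ≤ 4 * M * (r - ψ) * N ^ 2 := by gcongr
        _ = 4 * M * ((r - ψ) * N ^ 2) := by ring
        _ ≤ _ := by gcongr
    have : r * (3 * N ^ 2) ≤ r * (8 * M * κ ^ 2 + 8 * M * κ * N) := by linarith only [h7]
    exact le_of_mul_le_mul_left this hr
  by_contra! hlt
  have hlt' : 4 * (M * κ) < N := by rw [H.width]; linarith
  have hMκ := mul_pos hM hκ
  have hNpos : 0 < N := by linarith only [hlt', hMκ]
  have h7 : 4 * (M * κ) * N < N * N := mul_lt_mul_of_pos_right hlt' hNpos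
  have h8 : 8 * M * κ ^ 2 ≤ 2 * κ * N := by nlinarith only [hκ, hlt']
  have h9 : κ * N ≤ M * κ * N := by nlinarith only [mul_nonneg hκ.le hN, hM1]
  nlinarith only [h6, h7, h8, h9, mul_nonneg hκ.le hN]

/-- The touching circle bounds `v₂` below and the outer rolling ball bounds it above. Both circles
are nearly tangent to the line `v₂ = 0`, so both bounds are quadratic in `m`. -/
theorem touching_abs_le (H : RollingScale r α m M κ h) {u ψ v₁ v₂ N : ℝ}
    (hψ₁ : α * (α - ψ) ≤ κ ^ 2) (hN : 0 ≤ N) (hN4 : N ≤ 4 * m * α) (hout : 2 * r * v₂ ≤ N ^ 2)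
    (htouch : (v₁ - u) ^ 2 + (v₂ - ψ) ^ 2 = α ^ 2) : |v₂| ≤ 8 * m ^ 2 * α := by
  have hα := H.pos
  have hr := H.r_pos
  have hm := H.m_pos
  refine abs_le.2 ⟨?_, ?_⟩
  · have hψpos := H.half_le hψ₁
    have h1 : α ^ 2 - ψ ^ 2 ≤ 2 * κ ^ 2 := by nlinarith only [sq_nonneg (α - ψ), hψ₁]
    have h7 : -(2 * κ ^ 2) ≤ 2 * ψ * v₂ := by
      nlinarith only [sq_nonneg (v₁ - u), sq_nonneg v₂, htouch, h1]
    have h8 : κ ^ 2 ≤ (m * α) ^ 2 := by gcongr; exacts [H.κ_pos.le, H.κ_le]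
    by_contra! hlt
    have h9 : 0 < m ^ 2 * α := by positivity
    nlinarith only [h7, h8, h9, hlt, hψpos, hα]
  · have h7 : N ^ 2 ≤ (4 * m * α) ^ 2 := by gcongr
    have h8 : 2 * r * v₂ ≤ 2 * r * (8 * m ^ 2 * α) := by
      have : m ^ 2 * α * α ≤ m ^ 2 * α * r := by
        apply mul_le_mul_of_nonneg_left H.lt.le; positivity
      nlinarith only [this, hout, h7]
    exact le_of_mul_le_mul_left h8 (by positivity)

theorem touching_estimate (H : RollingScale r α m M κ h) (hn : IsRollingNormal r S p n)
    {u ψ : ℝ} (hu : |u| ≤ κ) (hψ₁ : α * (α - ψ) ≤ κ ^ 2) (hψ₂ : α * (ψ - α) ≤ M * κ ^ 2)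
    {q : Plane} (hq : q ∈ closure S) (htouch : ‖q - framePoint p n u ψ‖ = α) :
    ‖q - p‖ ≤ 4 * m * α ∧ |⟪q - p, n⟫| ≤ 8 * m ^ 2 * α :=
  have h1 := norm_sub_framePoint_sq hn.norm_eq q u ψ
  have h2 := touching_norm_le H hu hψ₁ hψ₂ (norm_nonneg _) (norm_sq_eq_add hn.norm_eq _)
    (hn.inner_le q hq) (by rw [← h1, htouch])
  ⟨h2, touching_abs_le H hψ₁ (norm_nonneg _) h2 (hn.inner_le q hq) (by rw [← h1, htouch])⟩

theorem segment_estimate {x y z p n : Plane} {a b : ℝ} (hz : z ∈ segment ℝ x y)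
    (hx : ‖x - p‖ ≤ a ∧ |⟪x - p, n⟫| ≤ b) (hy : ‖y - p‖ ≤ a ∧ |⟪y - p, n⟫| ≤ b) :
    ‖z - p‖ ≤ a ∧ |⟪z - p, n⟫| ≤ b := by
  obtain ⟨s, t, hs, ht, hst, rfl⟩ := hz
  have e : s • x + t • y - p = s • (x - p) + t • (y - p) := by
    have : p = (s + t) • p := by rw [hst, one_smul]
    nth_rewrite 1 [this]
    rw [add_smul, smul_sub, smul_sub]; abel
  have hb : a = s * a + t * a := by rw [← add_mul, hst, one_mul]
  have hb' : b = s * b + t * b := by rw [← add_mul, hst, one_mul]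
  rw [e]
  constructor
  · rw [hb]
    refine (norm_add_le _ _).trans ?_
    rw [norm_smul, norm_smul, Real.norm_of_nonneg hs, Real.norm_of_nonneg ht]
    gcongr
    exacts [hx.1, hy.1]
  · rw [inner_add_left, inner_smul_left, inner_smul_left, hb']
    simp only [conj_trivial]
    refine (abs_add_le _ _).trans ?_
    rw [abs_mul, abs_mul, abs_of_nonneg hs, abs_of_nonneg ht]
    gcongr
    exacts [hx.2, hy.2]

/-- A point close to `p` and almost in the tangent line is much closer to the frontier. -/
theorem exists_frontier_near (H : RollingScale r α m M κ h) (hn : IsRollingNormal r S p n)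
    {z : Plane} (hz : ‖z - p‖ ≤ 4 * m * α) (hz' : |⟪z - p, n⟫| ≤ 8 * m ^ 2 * α) :
    ∃ b ∈ frontier S, ‖z - b‖ ≤ 32 * m ^ 2 * α := by
  have hα := H.pos
  have hr := H.r_pos
  have hm := H.m_pos
  have hml := H.m_le
  set w := ⟪z - p, rot n⟫ with hw
  have hwle : w ^ 2 ≤ (4 * m * α) ^ 2 := by
    have := norm_sq_eq_add hn.norm_eq (z - p)
    have h2 : ‖z - p‖ ^ 2 ≤ (4 * m * α) ^ 2 := by gcongr
    nlinarith [sq_nonneg ⟪z - p, n⟫]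
  -- This height is large enough for the vertical segment through `z` to run from the inner rolling
  -- ball to the outer one, and so to cross the frontier.
  set y := 16 * m ^ 2 * α with hy
  have hypos : 0 < y := by positivity
  have hkey : w ^ 2 + y ^ 2 < 2 * r * y := by
    have h1 : y ^ 2 < 16 * m ^ 2 * α ^ 2 := by
      rw [hy]
      have : (16 * m ^ 2 * α) ^ 2 = (16 * m ^ 2 * α ^ 2) * (16 * m ^ 2) := by ring
      rw [this]
      have : 0 < 16 * m ^ 2 * α ^ 2 := by positivity
      have : 16 * m ^ 2 < 1 := by nlinarith only [hm, hml]
      nlinarith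
    have h2 : 32 * m ^ 2 * α * α ≤ 32 * m ^ 2 * α * r :=
      mul_le_mul_of_nonneg_left H.lt.le (by positivity)
    rw [hy]; nlinarith
  have hfp (t : ℝ) : ‖framePoint p n w t - p‖ ^ 2 = w ^ 2 + t ^ 2 := by
    rw [norm_sq_eq_add hn.norm_eq, inner_framePoint_sub hn.norm_eq,
      inner_framePoint_sub_rot hn.norm_eq]
  have hup : framePoint p n w y ∉ S := by
    intro hmem
    have := hn.inner_le _ (subset_closure hmem)
    rw [hfp, inner_framePoint_sub hn.norm_eq] at this
    linarith
  have hdown : framePoint p n w (-y) ∈ S := by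
    by_contra hmem
    have := hn.le_inner _ (subset_closure hmem)
    rw [hfp, inner_framePoint_sub hn.norm_eq] at this
    nlinarith
  have hconn : IsPreconnected ((fun t => framePoint p n w t) '' Icc (-y) y) :=
    isPreconnected_Icc.image _ (by fun_prop)
  obtain ⟨b, ⟨t, ht, rfl⟩, hb⟩ := hconn.exists_mem_frontier
    (mem_image_of_mem _ (left_mem_Icc.2 (by linarith))) hdown
    (mem_image_of_mem _ (right_mem_Icc.2 (by linarith))) hup
  refine ⟨_, hb, ?_⟩
  have h3 := norm_sub_framePoint_sq (p := p) hn.norm_eq z w t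
  rw [← hw, sub_self] at h3
  have h4 : ‖z - framePoint p n w t‖ ^ 2 = (⟪z - p, n⟫ - t) ^ 2 := by rw [h3]; ring
  refine (sq_le_sq₀ (norm_nonneg _) (by positivity)).1 ?_
  beta_reduce
  rw [h4]
  apply sq_le_sq'
  · have := abs_le.1 hz'; nlinarith [ht.1, ht.2]
  · have := abs_le.1 hz'; nlinarith [ht.1, ht.2]

end LocalEstimates
-- Position of a single edge and uniqueness of crossings
section EdgeEstimates

variable {r α m M κ h : ℝ} {S : Set Plane}

theorem mem_frontier_of_nearest {c p : Plane} (hp : p ∈ S)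
    (hcp : Metric.infDist c S = dist c p) (hpos : 0 < dist c p) :
    p ∈ frontier S ∧ Metric.ball c (dist c p) ∩ S = ∅ := by
  have hball : Metric.ball c (dist c p) ∩ S = ∅ := by
    rw [Set.eq_empty_iff_forall_notMem]
    rintro w ⟨hw, hwS⟩
    have := Metric.infDist_le_dist_of_mem (x := c) hwS
    rw [Metric.mem_ball, dist_comm] at hw
    linarith
  refine ⟨?_, hball⟩
  rw [frontier_eq_closure_inter_closure]
  refine ⟨subset_closure hp, ?_⟩
  have h1 : Metric.ball c (dist c p) ⊆ Sᶜ := by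
    intro w hw hwS
    exact (hball ▸ (⟨hw, hwS⟩ : w ∈ Metric.ball c (dist c p) ∩ S) : w ∈ (∅ : Set Plane))
  apply closure_mono h1
  rw [closure_ball c hpos.ne', Metric.mem_closedBall, dist_comm]

theorem inner_sub_eq_zero_of_norm_eq {x y c : Plane} (h : ‖x - c‖ = ‖y - c‖) :
    ⟪y - x, (x - c) + (y - c)⟫ = 0 := by
  have e : y - x = (y - c) - (x - c) := by abel
  rw [e, inner_sub_left, inner_add_right, inner_add_right, real_inner_self_eq_norm_sq,
    real_inner_self_eq_norm_sq, h, real_inner_comm]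
  ring

/-- Position of an edge on a ball of radius `α` that barely enters `S`, relative to the frontier
point nearest to one of the points of the edge. -/
theorem edge_estimate (H : RollingScale r α m M κ h) (hS : IsClosed S)
    (hnorm : ∀ p ∈ frontier S, ∃ n, IsRollingNormal r S p n) {x y c z p n : Plane}
    (hx : x ∈ S) (hy : y ∈ S) (hxc : ‖x - c‖ = α) (hyc : ‖y - c‖ = α)
    (hc : α - h < Metric.infDist c S) (hz : z ∈ segment ℝ x y)
    (hn : IsRollingNormal r S p n) (hzp : ‖z - p‖ = Metric.infDist z (frontier S)) :
    ‖z - p‖ ≤ 32 * m ^ 2 * α ∧ ‖x - p‖ ≤ 9 * m * α ∧ ‖y - p‖ ≤ 9 * m * α ∧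
      ‖c - (p + α • n)‖ ≤ 11 * m * α ∧ |⟪y - x, n⟫| ≤ 13 * m * ‖y - x‖ := by
  have hα := H.pos
  have hr := H.r_pos
  have hm := H.m_pos
  have hml := H.m_le
  have hmα := mul_pos hm hα
  have hm2 : m ^ 2 * α * 1000 ≤ m * α := by nlinarith only [hml, hmα]
  have hhle := H.h_le
  obtain ⟨p₀, hp₀S, hp₀⟩ := hS.exists_infDist_eq_dist ⟨x, hx⟩ c
  set ρ := dist c p₀ with hρ
  have hρα : ρ ≤ α := by
    rw [← hp₀, ← hxc, norm_sub_rev, ← dist_eq_norm]; exact Metric.infDist_le_dist_of_mem hx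
  have hρh : α - h < ρ := hp₀ ▸ hc
  have hρ2 : α / 2 ≤ ρ := by nlinarith
  obtain ⟨hfr, hball⟩ := mem_frontier_of_nearest hp₀S hp₀ (by linarith)
  obtain ⟨n₀, hn₀⟩ := hnorm p₀ hfr
  have hceq : c = p₀ + ρ • n₀ :=
    hn₀.eq_add_smul_of_ball_inter hr (by linarith) (dist_eq_norm c p₀).symm hball
  have hcf : c = framePoint p₀ n₀ 0 ρ := by rw [hceq, framePoint, zero_smul, add_zero]
  have hψ₁ : α * (α - ρ) ≤ κ ^ 2 := by
    rw [← H.depth]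
    have := H.one_le
    have := mul_pos hα H.h_pos
    nlinarith
  have hψ₂ : α * (ρ - α) ≤ M * κ ^ 2 := by
    have : 0 ≤ M * κ ^ 2 := mul_nonneg H.M_pos.le (sq_nonneg _)
    nlinarith
  have h0 : |(0 : ℝ)| ≤ κ := by rw [abs_zero]; exact H.κ_pos.le
  have ex := touching_estimate H hn₀ h0 hψ₁ hψ₂ (subset_closure hx) (by rw [← hcf, hxc])
  have ey := touching_estimate H hn₀ h0 hψ₁ hψ₂ (subset_closure hy) (by rw [← hcf, hyc])
  have ez := segment_estimate hz ex ey
  obtain ⟨b, hb, hzb⟩ := exists_frontier_near H hn₀ ez.1 ez.2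
  have hzp' : ‖z - p‖ ≤ 32 * m ^ 2 * α := by
    rw [hzp]
    refine (Metric.infDist_le_dist_of_mem hb).trans ?_
    rwa [dist_eq_norm]
  have hpp : ‖p₀ - p‖ ≤ 5 * m * α := by
    have e : p₀ - p = (z - p) - (z - p₀) := by abel
    rw [e]
    refine (norm_sub_le _ _).trans ?_
    linarith [ez.1]
  have hnn : ‖n₀ - n‖ ≤ 5 * m := by
    refine (hn₀.norm_sub_le hr hn).trans ?_
    rw [div_le_iff₀ hr]
    refine hpp.trans ?_
    exact mul_le_mul_of_nonneg_left H.lt.le (by positivity)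
  have hclose : ∀ q : Plane, ‖q - p₀‖ ≤ 4 * m * α → ‖q - p‖ ≤ 9 * m * α := by
    intro q hq
    have e : q - p = (q - p₀) + (p₀ - p) := by abel
    rw [e]
    refine (norm_add_le _ _).trans ?_
    linarith
  refine ⟨hzp', hclose x ex.1, hclose y ey.1, ?_, ?_⟩
  · have e : c - (p + α • n) = (p₀ - p) + ((ρ - α) • n₀ + α • (n₀ - n)) := by
      rw [hceq, sub_smul, smul_sub]; abel
    rw [e]
    refine (norm_add_le _ _).trans ?_
    have h1 : ‖(ρ - α) • n₀‖ ≤ h := by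
      rw [norm_smul, hn₀.norm_eq, mul_one, Real.norm_eq_abs, abs_le]
      constructor <;> linarith [H.h_pos]
    have h2 : ‖α • (n₀ - n)‖ ≤ α * (5 * m) := by
      rw [norm_smul, Real.norm_of_nonneg hα.le]; gcongr
    have h3 := norm_add_le ((ρ - α) • n₀) (α • (n₀ - n))
    linarith
  · have h1 := inner_sub_eq_zero_of_norm_eq (hxc.trans hyc.symm)
    -- The chord is orthogonal to this sum, whose dominant part is `-(2 * ρ) • n₀`; hence the chord
    -- is almost tangential.
    have e : (x - c) + (y - c) = (x - p₀) + (y - p₀) - (2 * ρ) • n₀ := by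
      rw [hceq, mul_smul, two_smul]; abel
    rw [e, inner_sub_right, inner_smul_right, sub_eq_zero] at h1
    have h2 : |⟪y - x, (x - p₀) + (y - p₀)⟫| ≤ ‖y - x‖ * (8 * m * α) := by
      refine (abs_real_inner_le_norm _ _).trans ?_
      gcongr
      refine (norm_add_le _ _).trans ?_
      linarith [ex.1, ey.1]
    rw [h1, abs_mul, abs_of_pos (by linarith : 0 < 2 * ρ)] at h2
    have h3 : α * |⟪y - x, n₀⟫| ≤ α * (8 * m * ‖y - x‖) := by
      have : α * |⟪y - x, n₀⟫| ≤ 2 * ρ * |⟪y - x, n₀⟫| := by gcongr; linarith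
      linarith
    have h4 := le_of_mul_le_mul_left h3 hα
    have h5 : |⟪y - x, n₀ - n⟫| ≤ ‖y - x‖ * (5 * m) :=
      (abs_real_inner_le_norm _ _).trans (by gcongr)
    have e2 : ⟪y - x, n⟫ = ⟪y - x, n₀⟫ - ⟪y - x, n₀ - n⟫ := by rw [inner_sub_right]; ring
    rw [e2]
    refine (abs_sub _ _).trans ?_
    linarith

theorem segment_sub_inner_le {x y z z' n : Plane} {a : ℝ} (h : |⟪y - x, n⟫| ≤ a * ‖y - x‖)
    (hz : z ∈ segment ℝ x y) (hz' : z' ∈ segment ℝ x y) : |⟪z - z', n⟫| ≤ a * ‖z - z'‖ := by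
  rw [segment_eq_image'] at hz hz'
  obtain ⟨t, -, rfl⟩ := hz
  obtain ⟨t', -, rfl⟩ := hz'
  have e : x + t • (y - x) - (x + t' • (y - x)) = (t - t') • (y - x) := by rw [sub_smul]; abel
  dsimp only
  rw [e, inner_smul_left, norm_smul, abs_mul, Real.norm_eq_abs]
  simp only [conj_trivial]
  nlinarith [abs_nonneg (t - t')]

/-- On a single edge, the nearest-point projection onto the frontier contracts distances only
slightly. -/
theorem edge_antilipschitz (H : RollingScale r α m M κ h) {p n p' n' z z' : Plane} {s s' : ℝ}
    (hn : IsRollingNormal r S p n) (hn' : IsRollingNormal r S p' n')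
    (hz : z = p + s • n) (hz' : z' = p' + s' • n') (hs' : |s'| ≤ 32 * m ^ 2 * α)
    (htilt : |⟪z - z', n⟫| ≤ 13 * m * ‖z - z'‖) :
    ‖z - z'‖ ≤ (1 + 300 * m ^ 2) * ‖p - p'‖ := by
  have hα := H.pos
  have hr := H.r_pos
  have hm := H.m_pos
  have hm2 : m ^ 2 ≤ 1 / 1000 := by nlinarith only [H.m_le, hm]
  have hm2p : 0 < m ^ 2 := by positivity
  have h1 := norm_sq_eq_add hn.norm_eq (z - z')
  have h2 : ⟪z - z', n⟫ ^ 2 ≤ 169 * m ^ 2 * ‖z - z'‖ ^ 2 := by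
    calc ⟪z - z', n⟫ ^ 2 = |⟪z - z', n⟫| ^ 2 := (sq_abs _).symm
      _ ≤ (13 * m * ‖z - z'‖) ^ 2 := by gcongr
      _ = _ := by ring
  -- By Pythagoras a tilt of order `m` shortens the tangential part only by order `m ^ 2`.
  have h3 : ‖z - z'‖ * (1 - 169 * m ^ 2) ≤ |⟪z - z', rot n⟫| := by
    refine (sq_le_sq₀ (mul_nonneg (norm_nonneg _) (by linarith)) (abs_nonneg _)).1 ?_
    rw [sq_abs, mul_pow]
    have : (1 - 169 * m ^ 2) ^ 2 ≤ 1 - 169 * m ^ 2 := by nlinarith only [hm2, hm2p]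
    nlinarith [sq_nonneg ‖z - z'‖]
  have e : ⟪z - z', rot n⟫ = ⟪p - p', rot n⟫ - s' * ⟪n' - n, rot n⟫ := by
    have e1 : z - z' = (p - p') + s • n - s' • n' := by rw [hz, hz']; abel
    rw [e1, inner_sub_left, inner_add_left, inner_smul_left, inner_smul_left, inner_sub_left n',
      inner_rot_self]
    simp
  have hrot : ‖rot n‖ = 1 := by rw [norm_rot, hn.norm_eq]
  have h4 : |⟪p - p', rot n⟫| ≤ ‖p - p'‖ := by
    have := abs_real_inner_le_norm (p - p') (rot n); rwa [hrot, mul_one] at this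
  have h5 : |⟪n' - n, rot n⟫| ≤ ‖p - p'‖ / r := by
    have h6 := abs_real_inner_le_norm (n' - n) (rot n)
    rw [hrot, mul_one] at h6
    have h7 := hn'.norm_sub_le hr hn
    rw [norm_sub_rev p'] at h7
    exact h6.trans h7
  have h6 : |s' * ⟪n' - n, rot n⟫| ≤ 32 * m ^ 2 * ‖p - p'‖ := by
    rw [abs_mul]
    calc |s'| * |⟪n' - n, rot n⟫| ≤ (32 * m ^ 2 * α) * (‖p - p'‖ / r) := by gcongr
      _ = 32 * m ^ 2 * ‖p - p'‖ * (α / r) := by ring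
      _ ≤ 32 * m ^ 2 * ‖p - p'‖ * 1 := by
        gcongr; exact (div_le_one hr).2 H.lt.le
      _ = _ := mul_one _
  have h7 : ‖z - z'‖ * (1 - 169 * m ^ 2) ≤ (1 + 32 * m ^ 2) * ‖p - p'‖ := by
    refine h3.trans ?_
    rw [e]
    refine (abs_sub _ _).trans ?_
    linarith
  have h8 : 1 + 32 * m ^ 2 ≤ (1 + 300 * m ^ 2) * (1 - 169 * m ^ 2) := by
    nlinarith only [hm2, hm2p]
  have h9 : (1 - 169 * m ^ 2) * ‖z - z'‖ ≤ (1 - 169 * m ^ 2) * ((1 + 300 * m ^ 2) * ‖p - p'‖) := by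
    have := mul_le_mul_of_nonneg_right h8 (norm_nonneg (p - p'))
    linarith
  exact le_of_mul_le_mul_left h9 (by linarith)

/-- Since `a` is at least as near to `c` as `b` is, `b - a` has nonnegative inner product with `(a -
c) + (b - c)`. That sum is `-(2 * α) • n` up to an error `4 * k`, so `b - a` can hardly point along
`n`. -/
theorem inner_sub_le_of_norm_le {a b c p n : Plane} {k : ℝ} (hab : ‖a - c‖ ≤ ‖b - c‖)
    (ha : ‖a - p‖ ≤ k) (hb : ‖b - p‖ ≤ k) (hc : ‖c - (p + α • n)‖ ≤ k) :
    α * ⟪b - a, n⟫ ≤ 2 * k * ‖b - a‖ := by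
  have h1 : 0 ≤ ⟪b - a, (a - c) + (b - c)⟫ := by
    have e : b - a = (b - c) - (a - c) := by abel
    rw [e, inner_sub_left, inner_add_right, inner_add_right, real_inner_self_eq_norm_sq,
      real_inner_self_eq_norm_sq, real_inner_comm (b - c)]
    nlinarith [norm_nonneg (a - c)]
  have e : (a - c) + (b - c) =
      ((a - p) + (b - p) - (2 : ℝ) • (c - (p + α • n))) - (2 * α) • n := by
    rw [mul_smul, two_smul, two_smul]; abel
  rw [e, inner_sub_right, inner_smul_right] at h1
  have h2 := real_inner_le_norm (b - a) ((a - p) + (b - p) - (2 : ℝ) • (c - (p + α • n)))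
  have h3 : ‖(a - p) + (b - p) - (2 : ℝ) • (c - (p + α • n))‖ ≤ 4 * k := by
    refine (norm_sub_le _ _).trans ?_
    rw [norm_smul]
    have := norm_add_le (a - p) (b - p)
    norm_num
    linarith
  have h4 := mul_le_mul_of_nonneg_left h3 (norm_nonneg (b - a))
  linarith

/-- For almost tangential vectors the product of the tangential parts dominates the product of the
normal parts. -/
theorem inner_pos_of_flat {n d D : Plane} (hn : ‖n‖ = 1) (hd : |⟪d, n⟫| ≤ 1 / 10 * ‖d‖)
    (hD : |⟪D, n⟫| ≤ 1 / 10 * ‖D‖) (hd' : 0 < ⟪d, rot n⟫) (hD' : 0 < ⟪D, rot n⟫) :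
    0 < ⟪d, D⟫ := by
  have key : ∀ v : Plane, |⟪v, n⟫| ≤ 1 / 10 * ‖v‖ → 0 < ⟪v, rot n⟫ → |⟪v, n⟫| < ⟪v, rot n⟫ := by
    intro v hv hv'
    have h1 := norm_sq_eq_add hn v
    have h2 : |⟪v, n⟫| ^ 2 ≤ (1 / 10 * ‖v‖) ^ 2 := by gcongr
    have h3 : |⟪v, n⟫| ^ 2 < ⟪v, rot n⟫ ^ 2 := by
      rw [← sq_abs ⟪v, n⟫] at h1
      nlinarith only [h1, h2, pow_pos hv' 2]
    exact (sq_lt_sq₀ (abs_nonneg _) hv'.le).1 h3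
  have h1 := key d hd hd'
  have h2 := key D hD hD'
  rw [inner_eq_add hn]
  have h3 : |⟪d, n⟫ * ⟪D, n⟫| < ⟪d, rot n⟫ * ⟪D, rot n⟫ := by
    rw [abs_mul]
    exact mul_lt_mul'' h1 h2 (abs_nonneg _) (abs_nonneg _)
  linarith [(abs_lt.1 h3).1]

theorem rot_ne_zero_of_flat {n D : Plane} (hn : ‖n‖ = 1)
    (hD : |⟪D, n⟫| ≤ 1 / 10 * ‖D‖) (hne : D ≠ 0) : ⟪D, rot n⟫ ≠ 0 := by
  intro h0
  have h1 := norm_sq_eq_add hn D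
  have h2 : |⟪D, n⟫| ^ 2 ≤ (1 / 10 * ‖D‖) ^ 2 := by gcongr
  rw [sq_abs] at h2
  rw [h0] at h1
  have h3 : 0 < ‖D‖ ^ 2 := by have := norm_pos_iff.2 hne; positivity
  nlinarith only [h1, h2, h3]

/-- If `a` and `b` lie on the boundaries of two balls of radius `α` with centres `c` and `c'`, and
neither lies in the other ball, then `a` being to the right of `b` excludes that `c'` is to the right
of `c`. -/
theorem not_center_lt {n p c c' a b : Plane} {k : ℝ} (hα : 0 < α) (hn : ‖n‖ = 1)
    (hk : 20 * k ≤ α) (hc : ‖c - (p + α • n)‖ ≤ k) (hc' : ‖c' - (p + α • n)‖ ≤ k)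
    (ha : ‖a - p‖ ≤ k) (hb : ‖b - p‖ ≤ k) (hac : ‖a - c‖ = α) (hac' : α ≤ ‖a - c'‖)
    (hbc' : ‖b - c'‖ = α) (hbc : α ≤ ‖b - c‖) (hab : 0 < ⟪a - b, rot n⟫) :
    ¬ 0 < ⟪c' - c, rot n⟫ := by
  intro hpos
  have flat : ∀ d : Plane, α * ⟪d, n⟫ ≤ 2 * k * ‖d‖ → α * -⟪d, n⟫ ≤ 2 * k * ‖d‖ →
      |⟪d, n⟫| ≤ 1 / 10 * ‖d‖ := by
    intro d h1 h2
    have h3 : α * |⟪d, n⟫| ≤ 2 * k * ‖d‖ := by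
      rcases abs_cases ⟪d, n⟫ with h | h <;> rw [h.1] <;> assumption
    have h4 : α * |⟪d, n⟫| ≤ α * (1 / 10 * ‖d‖) := by nlinarith [norm_nonneg d]
    exact le_of_mul_le_mul_left h4 hα
  have f1 : |⟪a - b, n⟫| ≤ 1 / 10 * ‖a - b‖ := by
    apply flat
    · exact inner_sub_le_of_norm_le (hbc'.trans_le hac') hb ha hc'
    · have := inner_sub_le_of_norm_le (hac.trans_le hbc) ha hb hc
      rwa [← inner_neg_left, neg_sub, norm_sub_rev a b]
  -- Seen from the centres with normal `-n`, the touched points lie near `p`. Points and centres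
  -- exchange roles, so the same flatness lemma applies to `c' - c`.
  have e : ∀ q : Plane, q - (p + α • n + α • -n) = q - p := by intro q; rw [smul_neg]; abel
  have f2 : |⟪c' - c, n⟫| ≤ 1 / 10 * ‖c' - c‖ := by
    apply flat
    · have := inner_sub_le_of_norm_le (α := α) (n := -n) (a := c') (b := c) (c := b)
        (by rw [norm_sub_rev, hbc', norm_sub_rev]; exact hbc) hc' hc (by rwa [e])
      rwa [inner_neg_right, ← inner_neg_left, neg_sub, norm_sub_rev c c'] at this
    · have := inner_sub_le_of_norm_le (α := α) (n := -n) (a := c) (b := c') (c := a)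
        (by rw [norm_sub_rev, hac, norm_sub_rev]; exact hac') hc hc' (by rwa [e])
      rwa [inner_neg_right] at this
  have h1 := inner_pos_of_flat hn f1 f2 hab hpos
  -- Both expansions together give `2 * ⟪a - c, c' - c⟫ ≤ ‖c' - c‖ ^ 2 ≤ 2 * ⟪b - c, c' - c⟫`, which
  -- contradicts the positive inner product of `a - b` and `c' - c`.
  have e1 : ‖a - c'‖ ^ 2 = ‖a - c‖ ^ 2 - 2 * ⟪a - c, c' - c⟫ + ‖c' - c‖ ^ 2 := by
    rw [← norm_sub_sq_real]; congr 2; abel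
  have e2 : ‖b - c'‖ ^ 2 = ‖b - c‖ ^ 2 - 2 * ⟪b - c, c' - c⟫ + ‖c' - c‖ ^ 2 := by
    rw [← norm_sub_sq_real]; congr 2; abel
  have e3 : ⟪a - b, c' - c⟫ = ⟪a - c, c' - c⟫ - ⟪b - c, c' - c⟫ := by
    rw [← inner_sub_left]; congr 1; abel
  rw [hac] at e1
  rw [hbc'] at e2
  nlinarith

/-- Each edge has its right end to the right of the other's left end. Hence neither centre is to the
right of the other, and an almost tangential vector without tangential part vanishes. -/
theorem center_eq_of_crossing {n p c c' x y x' y' : Plane} {k : ℝ} (hα : 0 < α) (hn : ‖n‖ = 1)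
    (hk : 20 * k ≤ α) (hc : ‖c - (p + α • n)‖ ≤ k) (hc' : ‖c' - (p + α • n)‖ ≤ k)
    (hx : ‖x - p‖ ≤ k) (hy : ‖y - p‖ ≤ k) (hx' : ‖x' - p‖ ≤ k) (hy' : ‖y' - p‖ ≤ k)
    (hxc : ‖x - c‖ = α) (hyc : ‖y - c‖ = α) (hxc' : ‖x' - c'‖ = α) (hyc' : ‖y' - c'‖ = α)
    (hxo : α ≤ ‖x - c'‖) (hyo : α ≤ ‖y - c'‖) (hxo' : α ≤ ‖x' - c‖) (hyo' : α ≤ ‖y' - c‖)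
    (hx0 : ⟪x - p, rot n⟫ < 0) (hy0 : 0 < ⟪y - p, rot n⟫)
    (hx0' : ⟪x' - p, rot n⟫ < 0) (hy0' : 0 < ⟪y' - p, rot n⟫) : c = c' := by
  have dec : ∀ a b : Plane, ⟪a - b, rot n⟫ = ⟪a - p, rot n⟫ - ⟪b - p, rot n⟫ := by
    intro a b; rw [← inner_sub_left]; congr 1; abel
  have h1 := not_center_lt hα hn hk hc hc' hy hx' hyc hyo hxc' hxo' (by rw [dec]; linarith)
  have h2 := not_center_lt hα hn hk hc' hc hy' hx hyc' hyo' hxc hxo (by rw [dec]; linarith)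
  by_contra hne
  have e : ∀ q : Plane, q - (p + α • n + α • -n) = q - p := by intro q; rw [smul_neg]; abel
  have f1 := inner_sub_le_of_norm_le (α := α) (n := -n) (a := c') (b := c) (c := x')
    (by rw [norm_sub_rev, hxc', norm_sub_rev]; exact hxo') hc' hc (by rwa [e])
  have f2 := inner_sub_le_of_norm_le (α := α) (n := -n) (a := c) (b := c') (c := x)
    (by rw [norm_sub_rev, hxc, norm_sub_rev]; exact hxo) hc hc' (by rwa [e])
  rw [inner_neg_right] at f1 f2
  have f3 : |⟪c' - c, n⟫| ≤ 1 / 10 * ‖c' - c‖ := by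
    rw [← inner_neg_left, neg_sub, norm_sub_rev] at f1
    have h4 : α * |⟪c' - c, n⟫| ≤ 2 * k * ‖c' - c‖ := by
      rcases abs_cases ⟪c' - c, n⟫ with h | h <;> rw [h.1] <;> assumption
    have h5 : α * |⟪c' - c, n⟫| ≤ α * (1 / 10 * ‖c' - c‖) := by nlinarith [norm_nonneg (c' - c)]
    exact le_of_mul_le_mul_left h5 hα
  have h3 := rot_ne_zero_of_flat hn f3 (sub_ne_zero.2 (Ne.symm hne))
  rcases lt_or_gt_of_ne h3 with h | h
  · apply h2
    rw [← neg_sub, inner_neg_left]; linarith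
  · exact h1 h

end EdgeEstimates
-- Existence of an edge across each normal line
section CrossingEdge

variable {r α m M κ h : ℝ} {S : Set Plane}

/-- By the choice of `h`, the left side equals `κ ^ 2 * (3 / 4 + α / (4 * r))`. The inequality keeps
the sliding ball high enough that at the ends of the window it touches only on its own side. -/
theorem RollingScale.floor_lt (H : RollingScale r α m M κ h) :
    2 * α * (3 / 2 * h + κ ^ 2 / (2 * r)) < κ ^ 2 := by
  have hr := H.r_pos
  have hM := H.M_pos
  have hκ := pow_pos H.κ_pos 2
  have h1 : 4 * α * h * r = κ ^ 2 * (r - α) := by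
    have : M * (4 * α * h * r) = M * (κ ^ 2 * (r - α)) := by
      linear_combination r * H.depth - κ ^ 2 * H.ratio
    exact mul_left_cancel₀ hM.ne' this
  have e : 2 * α * (3 / 2 * h + κ ^ 2 / (2 * r)) = (3 * α * h * r + α * κ ^ 2) / r := by
    field_simp
  rw [e, div_lt_iff₀ hr]
  nlinarith [H.lt, mul_pos hκ (sub_pos.2 H.lt)]

/-- Over the window the inner circle sinks by about `κ ^ 2 / (2 * r)`; the extra `h / 2` absorbs the
higher-order term `y ^ 2 < r * h`. -/
theorem frame_below_mem (H : RollingScale r α m M κ h) {p n : Plane}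
    (hn : IsRollingNormal r S p n) {u : ℝ} (hu : |u| ≤ κ) :
    framePoint p n u (-(κ ^ 2 / (2 * r) + h / 2)) ∈ S := by
  by_contra hmem
  have h1 := hn.le_inner _ (subset_closure hmem)
  rw [norm_sq_eq_add hn.norm_eq, inner_framePoint_sub hn.norm_eq,
    inner_framePoint_sub_rot hn.norm_eq] at h1
  have hr := H.r_pos
  have hα := H.pos
  have hM := H.M_pos
  have hh := H.h_pos
  have hκ := H.κ_pos
  set y := κ ^ 2 / (2 * r) + h / 2 with hy
  have hu2 : u ^ 2 ≤ κ ^ 2 := sq_le_sq' (abs_le.1 hu).1 (abs_le.1 hu).2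
  have e : 2 * r * y = κ ^ 2 + r * h := by rw [hy]; field_simp
  have hypos : 0 < y := by positivity
  have h2 : 2 * α * y < κ ^ 2 := by
    have := H.floor_lt
    have : 0 < 2 * α * h := by positivity
    rw [hy]; linarith
  -- `y ^ 2 < r * h`
  have h3 : y ^ 2 < r * h := by
    have h4 : α * y ≤ α * (5 / 2 * M * h) := by
      have h5 : κ ^ 2 / (2 * r) ≤ 2 * M * h := by
        rw [div_le_iff₀ (by positivity), ← H.depth]
        have : 4 * (M * h) * α ≤ 4 * (M * h) * r := by have := H.lt; gcongr
        linarith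
      have h6 : h ≤ M * h := by nlinarith [H.one_le]
      gcongr
      linarith
    have h4' : y ≤ 5 / 2 * M * h := le_of_mul_le_mul_left h4 hα
    have h7 : κ ^ 2 * M * 1000 ≤ α ^ 2 := by
      have : κ ^ 2 * M ≤ (m * α) * (m * α) := by
        calc κ ^ 2 * M = (M * κ) * κ := by ring
          _ ≤ (m * α) * (m * α) := by rw [H.width]; gcongr; exacts [(mul_pos H.m_pos hα).le, H.κ_le]
      have h8 : m * m * 1000 ≤ 1 := by nlinarith [H.m_pos, H.m_le]
      nlinarith [mul_pos hα hα]
    have h9 : 2 * y * α < α * r := by nlinarith [H.lt, H.one_le]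
    have h10 : 2 * α * y ^ 2 ≤ κ ^ 2 * (5 / 2 * M * h) := by
      calc 2 * α * y ^ 2 = (2 * α * y) * y := by ring
        _ ≤ κ ^ 2 * (5 / 2 * M * h) := by gcongr
    have h11 : κ ^ 2 * (5 / 2 * M * h) < 2 * α * (r * h) := by
      have h12 : α ^ 2 * h < α * r * h := by have := mul_pos hα hh; nlinarith [H.lt]
      nlinarith
    have := h10.trans_lt h11
    exact lt_of_mul_lt_mul_left (by linarith : (2 * α) * y ^ 2 < (2 * α) * (r * h)) (by positivity)
  nlinarith

/-- At height `b` the ball is clear of every point outside the outer rolling ball, so it contains no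
sample point. Coercivity of the quadratic in `v₁` and completing the square in `3 * v₁ - 4 * M * u`
give the bound. -/
theorem le_above_sq (H : RollingScale r α m M κ h) {u b v₁ v₂ N : ℝ} (hu : |u| ≤ κ)
    (hb : α * (b - α) = M * κ ^ 2) (hv : N ^ 2 = v₁ ^ 2 + v₂ ^ 2) (hout : 2 * r * v₂ ≤ N ^ 2) :
    α ^ 2 ≤ (v₁ - u) ^ 2 + (v₂ - b) ^ 2 := by
  have hr := H.r_pos
  have hα := H.pos
  have hM := H.M_pos
  have hM1 := H.one_le
  have hbr := H.ratio_mul_le hb.le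
  have hMκ : 0 ≤ M * κ ^ 2 := by positivity
  have hb0 : 0 ≤ b := by nlinarith
  have hu2 : u ^ 2 ≤ κ ^ 2 := sq_le_sq' (abs_le.1 hu).1 (abs_le.1 hu).2
  have h1 : b * (2 * r * v₂) ≤ b * N ^ 2 := mul_le_mul_of_nonneg_left hout hb0
  have hrb : 0 ≤ r - b := by nlinarith
  have h2 : (r - b) * v₁ ^ 2 ≤ (r - b) * N ^ 2 :=
    mul_le_mul_of_nonneg_left (by nlinarith only [hv, sq_nonneg v₂]) hrb
  have h3 : 3 * r * v₁ ^ 2 ≤ 4 * M * (r - b) * v₁ ^ 2 :=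
    mul_le_mul_of_nonneg_right hbr (sq_nonneg _)
  have h4 : r * ((v₁ - u) ^ 2 + (v₂ - b) ^ 2) ≥ (r - b) * v₁ ^ 2 - 2 * r * u * v₁ + r * u ^ 2
      + r * b ^ 2 := by
    have : (v₁ - u) ^ 2 + (v₂ - b) ^ 2 = N ^ 2 - 2 * u * v₁ - 2 * b * v₂ + u ^ 2 + b ^ 2 := by
      rw [hv]; ring
    rw [this]; nlinarith only [h1, h2]
  have h5 : r * (3 * v₁ ^ 2 - 8 * M * u * v₁ + 4 * M * u ^ 2 + 4 * M * b ^ 2) ≤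
      r * (4 * M * ((v₁ - u) ^ 2 + (v₂ - b) ^ 2)) := by
    have := mul_le_mul_of_nonneg_left h4 (by positivity : 0 ≤ 4 * M)
    nlinarith only [this, h3]
  have h6 := le_of_mul_le_mul_left h5 hr
  have h7 : α ^ 2 + 2 * (M * κ ^ 2) ≤ b ^ 2 := by nlinarith only [sq_nonneg (b - α), hb]
  have h8 : M ^ 2 * u ^ 2 ≤ M ^ 2 * κ ^ 2 := by gcongr
  have h9 : 4 * M * (α ^ 2 + 2 * (M * κ ^ 2)) ≤ 4 * M * b ^ 2 := by gcongr
  have h10 : 4 * M * α ^ 2 ≤ 4 * M * ((v₁ - u) ^ 2 + (v₂ - b) ^ 2) := by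
    have : 0 ≤ M * u ^ 2 := by positivity
    nlinarith only [h6, h8, h9, this, sq_nonneg (3 * v₁ - 4 * M * u),
      mul_nonneg (sq_nonneg M) (sq_nonneg κ)]
  exact le_of_mul_le_mul_left h10 (by positivity)

/-- A ball at the right (left) end of the window touches a point on the right (left). -/
theorem touching_side (H : RollingScale r α m M κ h) {u ψ v₁ v₂ N : ℝ}
    (hu : u ^ 2 = κ ^ 2) (hψ₁ : 2 * α * (α - ψ) < κ ^ 2) (hψ₂ : α * (ψ - α) ≤ M * κ ^ 2)
    (hψ₀ : 0 ≤ ψ) (hv : N ^ 2 = v₁ ^ 2 + v₂ ^ 2) (hout : 2 * r * v₂ ≤ N ^ 2)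
    (htouch : (v₁ - u) ^ 2 + (v₂ - ψ) ^ 2 = α ^ 2) : 0 < u * v₁ := by
  by_contra! hneg
  have hr := H.r_pos
  have hM := H.M_pos
  have hrψ : ψ ≤ r := by have := H.ratio_mul_le hψ₂; nlinarith
  -- Using `2 * ψ * v₂ ≤ N ^ 2` in the circle equation leaves `2 * u * v₁ ≥ κ ^ 2 + ψ ^ 2 - α ^ 2`,
  -- which is positive.
  have h1 : r * (2 * ψ * v₂) ≤ r * N ^ 2 := by
    calc r * (2 * ψ * v₂) = ψ * (2 * r * v₂) := by ring
      _ ≤ ψ * N ^ 2 := by gcongr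
      _ ≤ r * N ^ 2 := by gcongr
  have h2 := le_of_mul_le_mul_left h1 hr
  nlinarith only [h2, htouch, hv, hu, hψ₁, hneg, sq_nonneg (α - ψ)]

/-- Along every normal line that does not pass through a nearby sample point, the `α`-shape crosses
the normal line close to the frontier. -/
theorem exists_crossing_edge (H : RollingScale r α m M κ h) {p n : Plane} {𝒳 : Set Plane}
    (hn : IsRollingNormal r S p n) (hfin : 𝒳.Finite) (h𝒳 : 𝒳 ⊆ S)
    (hhit : ∀ c, Metric.infDist c S ≤ α - h → ∃ q ∈ 𝒳, ‖q - c‖ < α)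
    (hvert : ∀ q ∈ 𝒳, ∀ s : ℝ, |s| ≤ r / 2 → q ≠ p + s • n) :
    ∃ x y, IsAlphaEdge α 𝒳 x y ∧ ∃ z ∈ segment ℝ x y, ∃ s : ℝ, |s| ≤ 32 * m ^ 2 * α ∧
      z = p + s • n := by
  have hα := H.pos
  have hr := H.r_pos
  have hm := H.m_pos
  have hM := H.M_pos
  have hh := H.h_pos
  have hκ := H.κ_pos
  have hm2 : m ^ 2 ≤ 1 / 1000 := by nlinarith only [H.m_le, hm]
  -- At height `a` the centre is exactly `α - h` above a point of `S`, so the ball must be hit; at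
  -- height `b` it is empty. The resting height lies between.
  set a := α - (3 / 2 * h + κ ^ 2 / (2 * r)) with ha
  set b := α + M * κ ^ 2 / α with hb
  have hab : a ≤ b := by
    have : 0 ≤ M * κ ^ 2 / α := by positivity
    have : 0 ≤ κ ^ 2 / (2 * r) := by positivity
    linarith
  have hbα : α * (b - α) = M * κ ^ 2 := by rw [hb]; field_simp; ring
  have haα : 2 * α * (α - a) < κ ^ 2 := by rw [ha, sub_sub_cancel]; exact H.floor_lt
  have hψ : ∀ ψ ∈ Icc a b, 2 * α * (α - ψ) < κ ^ 2 ∧ α * (α - ψ) ≤ κ ^ 2 ∧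
      α * (ψ - α) ≤ M * κ ^ 2 := by
    intro ψ hψ
    have h1 : 2 * α * (α - ψ) < κ ^ 2 := by nlinarith [hψ.1]
    refine ⟨h1, by nlinarith [sq_nonneg κ], ?_⟩
    rw [← hbα]; nlinarith [hψ.2]
  set f : ℝ → ℝ → Plane := fun u ψ => framePoint p n u ψ with hf
  -- the sample points touched by an empty ball
  let touch (u ψ : ℝ) (q : Plane) : Prop := ‖q - f u ψ‖ = α ∧ ∀ q' ∈ 𝒳, α ≤ ‖q' - f u ψ‖
  have htouch : ∀ u ψ q, |u| ≤ κ → ψ ∈ Icc a b → q ∈ 𝒳 → touch u ψ q →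
      ‖q - p‖ ≤ 4 * m * α ∧ |⟪q - p, n⟫| ≤ 8 * m ^ 2 * α := by
    intro u ψ q hu hψm hq ht
    exact touching_estimate H hn hu (hψ ψ hψm).2.1 (hψ ψ hψm).2.2 (subset_closure (h𝒳 hq)) ht.1
  have hfloor : ∀ u, |u| ≤ κ → ∃ q ∈ 𝒳, ‖q - f u a‖ < α := by
    intro u hu
    refine hhit (f u a) ((Metric.infDist_le_dist_of_mem (frame_below_mem H hn hu)).trans ?_)
    have e : framePoint p n u a - framePoint p n u (-(κ ^ 2 / (2 * r) + h / 2)) = (α - h) • n := by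
      simp only [framePoint]
      rw [add_sub_add_left_eq_sub, ← sub_smul, ha]; congr 1; ring
    rw [dist_eq_norm, hf, e, norm_smul, hn.norm_eq, mul_one, Real.norm_of_nonneg]
    nlinarith [H.h_le]
  have hne : 𝒳.Nonempty := by
    obtain ⟨q, hq, -⟩ := hfloor 0 (by rw [abs_zero]; exact hκ.le)
    exact ⟨q, hq⟩
  have hexists : ∀ u, |u| ≤ κ → ∃ ψ ∈ Icc a b, ∃ q ∈ 𝒳, touch u ψ q := by
    intro u hu
    have hcont : ContinuousOn (fun ψ => Metric.infDist (f u ψ) 𝒳) (Icc a b) := by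
      apply Continuous.continuousOn
      apply (Metric.continuous_infDist_pt 𝒳).comp
      rw [hf]; fun_prop
    have hlow : Metric.infDist (f u a) 𝒳 ≤ α := by
      obtain ⟨q, hq, hqd⟩ := hfloor u hu
      refine (Metric.infDist_le_dist_of_mem hq).trans ?_
      rw [dist_comm, dist_eq_norm]; exact hqd.le
    have hhigh : α ≤ Metric.infDist (f u b) 𝒳 := by
      rw [Metric.le_infDist hne]
      intro q hq
      rw [dist_comm, dist_eq_norm]
      refine (sq_le_sq₀ hα.le (norm_nonneg _)).1 ?_
      rw [hf, norm_sub_framePoint_sq hn.norm_eq]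
      exact le_above_sq H hu hbα (norm_sq_eq_add hn.norm_eq _)
        (hn.inner_le q (subset_closure (h𝒳 hq)))
    obtain ⟨ψ, hψm, hψe⟩ := intermediate_value_Icc hab hcont ⟨hlow, hhigh⟩
    obtain ⟨q, hq, hqd⟩ := hfin.isCompact.exists_infDist_eq_dist hne (f u ψ)
    refine ⟨ψ, hψm, q, hq, ?_, fun q' hq' => ?_⟩
    · rw [← dist_eq_norm, dist_comm, ← hqd]; exact hψe
    · rw [← dist_eq_norm, dist_comm, ← hψe]; exact Metric.infDist_le_dist_of_mem hq'
  -- Projecting from a compact rectangle gives closedness without any continuity of the resting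
  -- height in `u`.
  have hclosed : ∀ 𝒴 ⊆ 𝒳, IsClosed {u | ∃ ψ ∈ Icc a b, |u| ≤ κ ∧ ∃ q ∈ 𝒴, touch u ψ q} := by
    intro 𝒴 h𝒴
    have hK : IsClosed {w : ℝ × ℝ | ∃ q ∈ 𝒴, touch w.1 w.2 q} := by
      have : {w : ℝ × ℝ | ∃ q ∈ 𝒴, touch w.1 w.2 q} =
          (⋃ q ∈ 𝒴, {w : ℝ × ℝ | ‖q - f w.1 w.2‖ = α}) ∩
            ⋂ q ∈ 𝒳, {w : ℝ × ℝ | α ≤ ‖q - f w.1 w.2‖} := by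
        ext w; simp [touch]; tauto
      rw [this]
      have hc : ∀ q : Plane, Continuous fun w : ℝ × ℝ => ‖q - f w.1 w.2‖ := by
        intro q; rw [hf]; fun_prop
      refine IsClosed.inter ((hfin.subset h𝒴).isClosed_biUnion fun q _ => ?_)
        (isClosed_biInter fun q _ => ?_)
      · exact isClosed_eq (hc q) continuous_const
      · exact isClosed_le continuous_const (hc q)
    have himg : {u | ∃ ψ ∈ Icc a b, |u| ≤ κ ∧ ∃ q ∈ 𝒴, touch u ψ q} =
        Prod.fst '' ((Icc (-κ) κ ×ˢ Icc a b) ∩ {w : ℝ × ℝ | ∃ q ∈ 𝒴, touch w.1 w.2 q}) := by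
      ext u
      constructor
      · rintro ⟨ψ, hψm, hu, hq⟩
        exact ⟨(u, ψ), ⟨⟨abs_le.1 hu, hψm⟩, hq⟩, rfl⟩
      · rintro ⟨⟨u', ψ⟩, ⟨⟨hu, hψm⟩, hq⟩, rfl⟩
        exact ⟨ψ, hψm, abs_le.2 hu, hq⟩
    rw [himg]
    exact (((isCompact_Icc.prod isCompact_Icc).inter_right hK).image continuous_fst).isClosed
  have hside : ∀ u ψ q, u ^ 2 = κ ^ 2 → ψ ∈ Icc a b → q ∈ 𝒳 → touch u ψ q →
      0 < u * ⟪q - p, rot n⟫ := by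
    intro u ψ q hu hψm hq ht
    have h1 := norm_sub_framePoint_sq (p := p) hn.norm_eq q u ψ
    refine touching_side H hu (hψ ψ hψm).1 (hψ ψ hψm).2.2 ?_ (norm_sq_eq_add hn.norm_eq (q - p))
      (hn.inner_le q (subset_closure (h𝒳 hq))) (by rw [← h1, ← ht.1])
    linarith [H.half_le (hψ ψ hψm).2.1]
  have hκabs : |κ| ≤ κ := (abs_of_pos hκ).le
  have hκabs' : |(-κ)| ≤ κ := by rw [abs_neg]; exact hκabs
  -- The positions that touch on the left and those that touch on the right are closed, cover the
  -- window and are both nonempty, so they share a position `u`.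
  obtain ⟨u, hu, ⟨ψ, hψm, hu', q, ⟨hq, hq0⟩, ht⟩, ⟨ψ', hψm', -, q', ⟨hq', hq0'⟩, ht'⟩⟩ :=
    isPreconnected_closed_iff.1 (isPreconnected_Icc : IsPreconnected (Icc (-κ) κ)) _ _
      (hclosed {q ∈ 𝒳 | ⟪q - p, rot n⟫ ≤ 0} (sep_subset _ _))
      (hclosed {q ∈ 𝒳 | 0 ≤ ⟪q - p, rot n⟫} (sep_subset _ _))
      (by
        intro u hu
        obtain ⟨ψ, hψm, q, hq, ht⟩ := hexists u (abs_le.2 hu)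
        rcases le_total ⟪q - p, rot n⟫ 0 with h0 | h0
        · exact Or.inl ⟨ψ, hψm, abs_le.2 hu, q, ⟨hq, h0⟩, ht⟩
        · exact Or.inr ⟨ψ, hψm, abs_le.2 hu, q, ⟨hq, h0⟩, ht⟩)
      (by
        obtain ⟨ψ, hψm, q, hq, ht⟩ := hexists (-κ) hκabs'
        have := hside _ _ _ (by ring) hψm hq ht
        exact ⟨-κ, ⟨le_rfl, by linarith⟩, ψ, hψm, hκabs', q, ⟨hq, by nlinarith⟩, ht⟩)
      (by
        obtain ⟨ψ, hψm, q, hq, ht⟩ := hexists κ hκabs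
        have := hside _ _ _ rfl hψm hq ht
        exact ⟨κ, ⟨by linarith, le_rfl⟩, ψ, hψm, hκabs, q, ⟨hq, by nlinarith⟩, ht⟩)
  -- the two balls coincide, since the lowest empty ball over `u` is unique
  have hle : ∀ ψ₁ ψ₂ q₁ q₂, ψ₁ ∈ Icc a b → ψ₂ ∈ Icc a b → q₁ ∈ 𝒳 → q₂ ∈ 𝒳 → touch u ψ₁ q₁ →
      touch u ψ₂ q₂ → ψ₂ ≤ ψ₁ := by
    intro ψ₁ ψ₂ q₁ q₂ hψ1 hψ2 hq1 hq2 ht1 ht2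
    by_contra! hlt
    have h1 := (htouch u ψ₂ q₂ hu' hψ2 hq2 ht2).2
    have h2 := H.half_le (hψ ψ₁ hψ1).2.1
    have h3 := ht1.2 q₂ hq2
    -- The point `q₂` lies well below both centres, so the lower ball would contain it.
    have h4 : ‖q₂ - f u ψ₂‖ ^ 2 ≤ ‖q₂ - f u ψ₁‖ ^ 2 := by rw [ht2.1]; gcongr
    rw [hf, norm_sub_framePoint_sq hn.norm_eq, norm_sub_framePoint_sq hn.norm_eq] at h4
    have h5 := (abs_le.1 h1).2
    have h6 : 8 * m ^ 2 * α < α / 2 := by nlinarith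
    nlinarith only [h4, hlt, h2, h5, h6]
  have hψeq : ψ = ψ' :=
    le_antisymm (hle ψ' ψ q' q hψm' hψm hq' hq ht' ht) (hle ψ ψ' q q' hψm hψm' hq hq' ht ht')
  subst hψeq
  have hnv : ∀ q ∈ 𝒳, touch u ψ q → ⟪q - p, rot n⟫ ≠ 0 := by
    intro q hq ht h0
    have h1 := (htouch u ψ q hu' hψm hq ht).2
    refine hvert q hq ⟪q - p, n⟫ (h1.trans ?_) ?_
    · nlinarith [H.lt]
    · have := eq_framePoint hn.norm_eq p q
      rwa [h0, framePoint, zero_smul, add_zero] at this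
  have hq1 := lt_of_le_of_ne hq0 (hnv q hq ht)
  have hq1' := lt_of_le_of_ne hq0' (hnv q' hq' ht').symm
  refine ⟨q, q', ⟨hq, hq', ?_, f u ψ, ?_, ?_, ?_⟩, ?_⟩
  · rintro rfl; linarith
  · rw [Metric.mem_sphere, dist_eq_norm]; exact ht.1
  · rw [Metric.mem_sphere, dist_eq_norm]; exact ht'.1
  · rw [Set.eq_empty_iff_forall_notMem]
    rintro w ⟨hw, hw𝒳⟩
    rw [Metric.mem_ball, dist_eq_norm] at hw
    linarith [ht.2 w hw𝒳]
  · set v := ⟪q - p, rot n⟫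
    set v' := ⟪q' - p, rot n⟫
    have hden : 0 < v' - v := by linarith
    have hz : (v' / (v' - v)) • q + (-v / (v' - v)) • q' ∈ segment ℝ q q' :=
      ⟨_, _, div_nonneg hq1'.le hden.le, div_nonneg (by linarith) hden.le, by field_simp; ring, rfl⟩
    refine ⟨_, hz, ⟪(v' / (v' - v)) • q + (-v / (v' - v)) • q' - p, n⟫, ?_, ?_⟩
    · refine (segment_estimate hz (htouch u ψ q hu' hψm hq ht)
        (htouch u ψ q' hu' hψm hq' ht')).2.trans ?_
      nlinarith [mul_pos (pow_pos hm 2) hα]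
    · have h0 : ⟪(v' / (v' - v)) • q + (-v / (v' - v)) • q' - p, rot n⟫ = 0 := by
        have e : (v' / (v' - v)) • q + (-v / (v' - v)) • q' - p =
            (v' / (v' - v)) • (q - p) + (-v / (v' - v)) • (q' - p) := by
          have : p = (v' / (v' - v) + -v / (v' - v)) • p := by
            rw [← add_div, ← sub_eq_add_neg, div_self hden.ne', one_smul]
          nth_rewrite 1 [this]
          rw [add_smul, smul_sub, smul_sub]; abel
        rw [e, inner_add_left, inner_smul_left, inner_smul_left]
        simp only [conj_trivial]
        change v' / (v' - v) * v + -v / (v' - v) * v' = 0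
        ring
      have := eq_framePoint hn.norm_eq p ((v' / (v' - v)) • q + (-v / (v' - v)) • q')
      rwa [h0, framePoint, zero_smul, add_zero] at this

end CrossingEdge
-- Comparison of the two lengths for a hitting sample
section LengthComparison

/-- Taking `x = x'` shows that the relation is single-valued, so it is a `K`-Lipschitz map on its
domain. The relational form leaves normals and nearest points existential. -/
theorem hausdorffMeasure_le_of_relation {X Y : Type*} [MetricSpace X] [MeasurableSpace X]
    [BorelSpace X] [MetricSpace Y] [MeasurableSpace Y] [BorelSpace Y] {R : X → Y → Prop} {K : ℝ}
    (hK : 0 ≤ K) {D : Set X} {B : Set Y} (hB : ∀ y ∈ B, ∃ x ∈ D, R x y)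
    (hR : ∀ x x' y y', R x y → R x' y' → dist y y' ≤ K * dist x x') :
    μH[1] B ≤ ENNReal.ofReal K * μH[1] D := by
  rcases B.eq_empty_or_nonempty with rfl | ⟨y₀, -⟩
  · simp
  classical
  let f : X → Y := fun x => if hx : ∃ y, R x y then hx.choose else y₀
  have hf : ∀ x y, R x y → R x (f x) := by
    intro x y hxy
    have hx : ∃ y, R x y := ⟨y, hxy⟩
    simp only [f, dif_pos hx]
    exact hx.choose_spec
  have hsub : B ⊆ f '' {x ∈ D | ∃ y, R x y} := by
    intro y hy
    obtain ⟨x, hx, hxy⟩ := hB y hy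
    refine ⟨x, ⟨hx, y, hxy⟩, ?_⟩
    have := hR x x _ _ (hf x y hxy) hxy
    rw [dist_self, mul_zero] at this
    exact dist_le_zero.1 this
  have hlip : LipschitzOnWith K.toNNReal f {x ∈ D | ∃ y, R x y} := by
    refine LipschitzOnWith.of_dist_le_mul ?_
    rintro x ⟨-, y, hxy⟩ x' ⟨-, y', hxy'⟩
    rw [Real.coe_toNNReal K hK]
    exact hR _ _ _ _ (hf x y hxy) (hf x' y' hxy')
  calc μH[1] B ≤ μH[1] (f '' {x ∈ D | ∃ y, R x y}) := measure_mono hsub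
    _ ≤ (K.toNNReal : ℝ≥0∞) ^ (1 : ℝ) * μH[1] {x ∈ D | ∃ y, R x y} :=
        hlip.hausdorffMeasure_image_le zero_le_one
    _ ≤ ENNReal.ofReal K * μH[1] D := by
        rw [ENNReal.rpow_one]
        gcongr
        · rfl
        · exact sep_subset _ _

variable {r α m M κ h : ℝ} {S : Set Plane} {𝒳 : Set Plane}

/-- The frontier points whose normal line passes through a nearby point of `𝒳`. -/
def sampleFeet (r : ℝ) (S 𝒳 : Set Plane) : Set Plane :=
  {p | p ∈ frontier S ∧ ∃ q ∈ 𝒳, ∃ n, IsRollingNormal r S p n ∧ ∃ s : ℝ, |s| ≤ r / 2 ∧ q = p + s • n}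

theorem finite_sampleFeet (hr : 0 < r) (h𝒳 : 𝒳.Finite) : (sampleFeet r S 𝒳).Finite := by
  refine (h𝒳.biUnion (t := fun q => {p | p ∈ frontier S ∧ ∃ n, IsRollingNormal r S p n ∧
    ∃ s : ℝ, |s| ≤ r / 2 ∧ q = p + s • n}) fun q _ => ?_).subset ?_
  · apply Set.Subsingleton.finite
    rintro p ⟨hp, n, hn, s, hs, hq⟩ p' ⟨hp', n', hn', s', hs', hq'⟩
    -- With `η = r / 2`, two feet of the same point must coincide.
    have := hn.norm_sub_mul_le hr hn' hp hp' hs hs'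
    rw [← hq, ← hq', sub_self, norm_zero] at this
    have e : 1 - r / 2 / r = 1 / 2 := by field_simp; norm_num
    rw [e] at this
    exact sub_eq_zero.1 (norm_le_zero_iff.1 (by linarith))
  · rintro p ⟨hp, q, hq, n, hn, s, hs, hqs⟩
    exact mem_biUnion hq ⟨hp, n, hn, s, hs, hqs⟩

theorem RollingScale.sq_le (H : RollingScale r α m M κ h) : m ^ 2 ≤ 1 / 1000000 := by
  nlinarith [H.m_pos, H.m_le]

/-- Apart from a finite, hence null, set of feet, every frontier point is the projection of a point
where an edge crosses its normal. The projection is Lipschitz with constant `(1 - 32 * m ^ 2)⁻¹`. -/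
theorem hausdorffMeasure_frontier_le (H : RollingScale r α m M κ h)
    (hnorm : ∀ p ∈ frontier S, ∃ n, IsRollingNormal r S p n) (hfin : 𝒳.Finite) (h𝒳 : 𝒳 ⊆ S)
    (hhit : ∀ c, Metric.infDist c S ≤ α - h → ∃ q ∈ 𝒳, ‖q - c‖ < α) :
    μH[1] (frontier S) ≤ ENNReal.ofReal (1 + 300 * m ^ 2) * μH[1] (alphaShape α 𝒳) := by
  have hr := H.r_pos
  have hm2 := H.sq_le
  have hm := H.m_pos
  have hm2p : 0 < m ^ 2 := by positivity
  have := Measure.nullSingletonClass_hausdorff Plane zero_lt_one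
  have hF : μH[1] (sampleFeet r S 𝒳) = 0 := (finite_sampleFeet hr hfin).measure_zero _
  have h1 : μH[1] (frontier S) = μH[1] (frontier S \ sampleFeet r S 𝒳) :=
    (measure_sdiff_null hF).symm
  rw [h1]
  refine hausdorffMeasure_le_of_relation (R := fun z p => p ∈ frontier S ∧ ∃ n,
    IsRollingNormal r S p n ∧ ∃ s : ℝ, |s| ≤ 32 * m ^ 2 * α ∧ z = p + s • n) (by positivity) ?_ ?_
  · rintro p ⟨hp, hpF⟩
    obtain ⟨n, hn⟩ := hnorm p hp
    obtain ⟨x, y, hxy, z, hz, s, hs, hzs⟩ := exists_crossing_edge H hn hfin h𝒳 hhit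
      fun q hq s hs hqs => hpF ⟨hp, q, hq, n, hn, s, hs, hqs⟩
    exact ⟨z, ⟨x, y, hxy, hz⟩, hp, n, hn, s, hs, hzs⟩
  · rintro z z' p p' ⟨hp, n, hn, s, hs, hz⟩ ⟨hp', n', hn', s', hs', hz'⟩
    have h2 := hn.norm_sub_mul_le hr hn' hp hp' hs hs'
    rw [← hz, ← hz'] at h2
    rw [dist_eq_norm, dist_eq_norm]
    have h3 : 32 * m ^ 2 * α / r ≤ 32 * m ^ 2 := by
      rw [div_le_iff₀ hr]; exact mul_le_mul_of_nonneg_left H.lt.le (by positivity)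
    have h4 : ‖p - p'‖ * (1 - 32 * m ^ 2) ≤ ‖z - z'‖ :=
      (mul_le_mul_of_nonneg_left (by linarith) (norm_nonneg _)).trans h2
    have h5 : 1 ≤ (1 + 300 * m ^ 2) * (1 - 32 * m ^ 2) := by nlinarith only [hm2, hm2p]
    have h6 := mul_le_mul_of_nonneg_left h4 (by positivity : 0 ≤ 1 + 300 * m ^ 2)
    nlinarith [norm_nonneg (p - p')]

/-- No three points of `𝒳` lie on a common circle of radius `α`. -/
def InGeneralPosition (α : ℝ) (𝒳 : Set Plane) : Prop :=
  ∀ x ∈ 𝒳, ∀ y ∈ 𝒳, ∀ w ∈ 𝒳, x ≠ y → w ≠ x → w ≠ y →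
    ∀ c, ‖x - c‖ = α → ‖y - c‖ = α → ‖w - c‖ ≠ α

/-- The segments that make up the `α`-shape. -/
def alphaSegments (α : ℝ) (𝒳 : Set Plane) : Set (Set Plane) :=
  {e | ∃ x y, IsAlphaEdge α 𝒳 x y ∧ e = segment ℝ x y}

theorem finite_alphaSegments (hfin : 𝒳.Finite) : (alphaSegments α 𝒳).Finite := by
  refine ((hfin.prod hfin).image fun w : Plane × Plane => segment ℝ w.1 w.2).subset ?_
  rintro e ⟨x, y, hxy, rfl⟩
  exact ⟨(x, y), ⟨hxy.1, hxy.2.1⟩, rfl⟩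

theorem alphaShape_eq_sUnion : alphaShape α 𝒳 = ⋃ e ∈ alphaSegments α 𝒳, e := by
  ext z
  simp only [alphaShape, alphaSegments, mem_ofPred_eq, mem_iUnion]
  constructor
  · rintro ⟨x, y, hxy, hz⟩
    exact ⟨_, ⟨x, y, hxy, rfl⟩, hz⟩
  · rintro ⟨_, ⟨x, y, hxy, rfl⟩, hz⟩
    exact ⟨x, y, hxy, hz⟩

theorem hausdorffMeasure_alphaShape_lt_top (hfin : 𝒳.Finite) : μH[1] (alphaShape α 𝒳) < ⊤ := by
  rw [alphaShape_eq_sUnion]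
  refine measure_biUnion_lt_top (finite_alphaSegments hfin) ?_
  rintro e ⟨x, y, -, rfl⟩
  rw [hausdorffMeasure_segment]
  exact edist_lt_top x y

/-- The frontier points that are nearest to some point of `e`. -/
def nearestFeet (S e : Set Plane) : Set Plane :=
  Prod.snd '' ((e ×ˢ frontier S) ∩
    {w : Plane × Plane | dist w.1 w.2 = Metric.infDist w.1 (frontier S)})

/-- Keeping all nearest points makes the set of feet compact, hence measurable, as additivity over
edges requires. -/
theorem isCompact_nearestFeet {e : Set Plane} (hS : IsCompact (frontier S)) (he : IsCompact e) :
    IsCompact (nearestFeet S e) := by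
  refine ((he.prod hS).inter_right ?_).image continuous_snd
  exact isClosed_eq (by fun_prop) ((Metric.continuous_infDist_pt _).comp continuous_fst)

theorem isCompact_segment (x y : Plane) : IsCompact (segment ℝ x y) := by
  rw [segment_eq_image']
  exact isCompact_Icc.image (by fun_prop)

/-- The ball of an edge is empty, so the hitting property keeps its centre more than `α - h` away
from `S`. -/
theorem edge_data (hhit : ∀ c, Metric.infDist c S ≤ α - h →
    ∃ q ∈ 𝒳, ‖q - c‖ < α) {x y : Plane} (hxy : IsAlphaEdge α 𝒳 x y) :
    ∃ c, ‖x - c‖ = α ∧ ‖y - c‖ = α ∧ (∀ q ∈ 𝒳, α ≤ ‖q - c‖) ∧ α - h < Metric.infDist c S := by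
  obtain ⟨-, -, -, c, hxc, hyc, hemp⟩ := hxy
  have hout : ∀ q ∈ 𝒳, α ≤ ‖q - c‖ := by
    intro q hq
    by_contra! hlt
    rw [Set.eq_empty_iff_forall_notMem] at hemp
    exact hemp q ⟨by rwa [Metric.mem_ball, dist_eq_norm], hq⟩
  refine ⟨c, by rwa [← dist_eq_norm], by rwa [← dist_eq_norm], hout, ?_⟩
  by_contra! hle
  obtain ⟨q, hq, hlt⟩ := hhit c hle
  exact absurd (hout q hq) hlt.not_ge

theorem hausdorffMeasure_segment_le (H : RollingScale r α m M κ h) (hS : IsClosed S)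
    (hSc : IsCompact (frontier S)) (hfr : (frontier S).Nonempty)
    (hnorm : ∀ p ∈ frontier S, ∃ n, IsRollingNormal r S p n) (h𝒳 : 𝒳 ⊆ S)
    (hhit : ∀ c, Metric.infDist c S ≤ α - h → ∃ q ∈ 𝒳, ‖q - c‖ < α) {x y : Plane}
    (hxy : IsAlphaEdge α 𝒳 x y) :
    μH[1] (segment ℝ x y) ≤
      ENNReal.ofReal (1 + 300 * m ^ 2) * μH[1] (nearestFeet S (segment ℝ x y)) := by
  have hr := H.r_pos
  obtain ⟨c, hxc, hyc, -, hc⟩ := edge_data hhit hxy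
  refine hausdorffMeasure_le_of_relation (R := fun p z => z ∈ segment ℝ x y ∧ p ∈ frontier S ∧
    ‖z - p‖ = Metric.infDist z (frontier S)) (by positivity) ?_ ?_
  · intro z hz
    obtain ⟨p, hp, hpd⟩ := hSc.exists_infDist_eq_dist hfr z
    exact ⟨p, ⟨(z, p), ⟨⟨hz, hp⟩, hpd.symm⟩, rfl⟩, hz, hp, by rw [hpd, dist_eq_norm]⟩
  · rintro p p' z z' ⟨hz, hp, hzp⟩ ⟨hz', hp', hzp'⟩
    obtain ⟨n, hn⟩ := hnorm p hp
    obtain ⟨n', hn'⟩ := hnorm p' hp'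
    have h1 := edge_estimate H hS hnorm (h𝒳 hxy.1) (h𝒳 hxy.2.1) hxc hyc hc hz hn hzp
    have h2 := edge_estimate H hS hnorm (h𝒳 hxy.1) (h𝒳 hxy.2.1) hxc hyc hc hz' hn' hzp'
    obtain ⟨s, hs, hzs⟩ := hn.exists_eq_add_smul hr hzp
    obtain ⟨s', hs', hzs'⟩ := hn'.exists_eq_add_smul hr hzp'
    rw [dist_eq_norm, dist_eq_norm]
    exact edge_antilipschitz H hn hn' hzs hzs' (hs'.trans_le h2.1)
      (segment_sub_inner_le h1.2.2.2.2 hz hz')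

/-- The edge meets the normal line at `p`, and no endpoint is on that line since `p` is not a foot
of the sample. The endpoints are thus strictly on opposite sides and can be named from left to
right. -/
theorem exists_oriented_edge (H : RollingScale r α m M κ h) (hS : IsClosed S)
    (hnorm : ∀ p ∈ frontier S, ∃ n, IsRollingNormal r S p n) (h𝒳 : 𝒳 ⊆ S)
    (hhit : ∀ c, Metric.infDist c S ≤ α - h → ∃ q ∈ 𝒳, ‖q - c‖ < α) {e : Set Plane}
    (he : e ∈ alphaSegments α 𝒳) {p n : Plane} (hn : IsRollingNormal r S p n)
    (hp : p ∈ nearestFeet S e) (hpF : p ∉ sampleFeet r S 𝒳) :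
    ∃ x y c, x ∈ 𝒳 ∧ y ∈ 𝒳 ∧ x ≠ y ∧ e = segment ℝ x y ∧ ‖x - c‖ = α ∧ ‖y - c‖ = α ∧
      (∀ q ∈ 𝒳, α ≤ ‖q - c‖) ∧ ‖x - p‖ ≤ 11 * m * α ∧ ‖y - p‖ ≤ 11 * m * α ∧
      ‖c - (p + α • n)‖ ≤ 11 * m * α ∧ ⟪x - p, rot n⟫ < 0 ∧ 0 < ⟪y - p, rot n⟫ := by
  have hr := H.r_pos
  have hmα := mul_pos H.m_pos H.pos
  obtain ⟨x, y, hxy, rfl⟩ := he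
  obtain ⟨⟨z, p⟩, ⟨⟨hz, hpS⟩, hzp⟩, rfl⟩ := hp
  dsimp only at hz hpS hzp hn hpF ⊢
  rw [mem_ofPred_eq, dist_eq_norm] at hzp
  dsimp only at hzp
  obtain ⟨c, hxc, hyc, hout, hc⟩ := edge_data hhit hxy
  obtain ⟨-, hxp, hyp, hcp, -⟩ :=
    edge_estimate H hS hnorm (h𝒳 hxy.1) (h𝒳 hxy.2.1) hxc hyc hc hz hn hzp
  have hnv : ∀ q ∈ 𝒳, ‖q - p‖ ≤ 9 * m * α → ⟪q - p, rot n⟫ ≠ 0 := by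
    intro q hq hqp h0
    refine hpF ⟨hpS, q, hq, n, hn, ⟪q - p, n⟫, ?_, ?_⟩
    · have h1 := abs_real_inner_le_norm (q - p) n
      rw [hn.norm_eq, mul_one] at h1
      nlinarith [H.lt, H.m_le, H.pos]
    · have := eq_framePoint hn.norm_eq p q
      rwa [h0, framePoint, zero_smul, add_zero] at this
  have hx0 := hnv x hxy.1 hxp
  have hy0 := hnv y hxy.2.1 hyp
  obtain ⟨s, -, hzs⟩ := hn.exists_eq_add_smul hr hzp
  have hz0 : ⟪z - p, rot n⟫ = 0 := by
    rw [hzs, add_sub_cancel_left, inner_smul_left, inner_rot_self, mul_zero]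
  obtain ⟨a, b, ha, hb, hab, hzab⟩ := hz
  have hcomb : a * ⟪x - p, rot n⟫ + b * ⟪y - p, rot n⟫ = 0 := by
    have e : z - p = a • (x - p) + b • (y - p) := by
      have : p = (a + b) • p := by rw [hab, one_smul]
      rw [← hzab]
      nth_rewrite 1 [this]
      rw [add_smul, smul_sub, smul_sub]; abel
    rw [e, inner_add_left, inner_smul_left, inner_smul_left] at hz0
    simpa using hz0
  have hx9 : ‖x - p‖ ≤ 11 * m * α := hxp.trans (by linarith)
  have hy9 : ‖y - p‖ ≤ 11 * m * α := hyp.trans (by linarith)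
  rcases lt_or_gt_of_ne hx0 with hx1 | hx1 <;> rcases lt_or_gt_of_ne hy0 with hy1 | hy1
  · exfalso; rcases ha.eq_or_lt with rfl | ha
    · have : b = 1 := by linarith
      subst this; linarith
    · nlinarith
  · exact ⟨x, y, c, hxy.1, hxy.2.1, hxy.2.2.1, rfl, hxc, hyc, hout, hx9, hy9, hcp, hx1, hy1⟩
  · exact ⟨y, x, c, hxy.2.1, hxy.1, hxy.2.2.1.symm, segment_symm ℝ x y, hyc, hxc, hout, hy9, hx9,
      hcp, hy1, hx1⟩
  · exfalso; rcases ha.eq_or_lt with rfl | ha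
    · have : b = 1 := by linarith
      subst this; linarith
    · nlinarith

/-- Two edges over the same foot share their empty ball. In general position that circle carries
only two sample points, and orientation matches the endpoints. -/
theorem pairwiseDisjoint_nearestFeet (H : RollingScale r α m M κ h) (hS : IsClosed S)
    (hnorm : ∀ p ∈ frontier S, ∃ n, IsRollingNormal r S p n) (h𝒳 : 𝒳 ⊆ S)
    (hhit : ∀ c, Metric.infDist c S ≤ α - h → ∃ q ∈ 𝒳, ‖q - c‖ < α)
    (hgen : InGeneralPosition α 𝒳) :
    (alphaSegments α 𝒳).PairwiseDisjoint fun e => nearestFeet S e \ sampleFeet r S 𝒳 := by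
  intro e he e' he' hne
  rw [Function.onFun, Set.disjoint_left]
  rintro p ⟨hp, hpF⟩ ⟨hp', -⟩
  apply hne
  have hpS : p ∈ frontier S := by
    obtain ⟨w, ⟨⟨-, hw⟩, -⟩, rfl⟩ := hp
    exact hw
  obtain ⟨n, hn⟩ := hnorm p hpS
  obtain ⟨x, y, c, hx, hy, hxy, rfl, hxc, hyc, hout, hxp, hyp, hcp, hx0, hy0⟩ :=
    exists_oriented_edge H hS hnorm h𝒳 hhit he hn hp hpF
  obtain ⟨x', y', c', hx', hy', hxy', rfl, hxc', hyc', hout', hxp', hyp', hcp', hx0', hy0'⟩ :=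
    exists_oriented_edge H hS hnorm h𝒳 hhit he' hn hp' hpF
  have hk : 20 * (11 * m * α) ≤ α := by nlinarith [H.m_le, H.pos]
  have hcc : c = c' := center_eq_of_crossing H.pos hn.norm_eq hk hcp hcp' hxp hyp hxp' hyp' hxc hyc
    hxc' hyc' (hout' x hx) (hout' y hy) (hout x' hx') (hout y' hy') hx0 hy0 hx0' hy0'
  subst hcc
  have hx'm : x' = x := by
    by_contra h1
    by_cases h2 : x' = y
    · rw [h2] at hx0'; linarith
    · exact hgen x hx y hy x' hx' hxy h1 h2 c hxc hyc hxc'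
  have hy'm : y' = y := by
    by_contra h1
    by_cases h2 : y' = x
    · rw [h2] at hy0'; linarith
    · exact hgen x hx y hy y' hy' hxy h2 h1 c hxc hyc hyc'
  rw [hx'm, hy'm]

theorem hausdorffMeasure_alphaShape_le (H : RollingScale r α m M κ h) (hS : IsCompact S)
    (hfr : (frontier S).Nonempty)
    (hnorm : ∀ p ∈ frontier S, ∃ n, IsRollingNormal r S p n) (hfin : 𝒳.Finite) (h𝒳 : 𝒳 ⊆ S)
    (hhit : ∀ c, Metric.infDist c S ≤ α - h → ∃ q ∈ 𝒳, ‖q - c‖ < α)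
    (hgen : InGeneralPosition α 𝒳) :
    μH[1] (alphaShape α 𝒳) ≤ ENNReal.ofReal (1 + 300 * m ^ 2) * μH[1] (frontier S) := by
  have hSc : IsCompact (frontier S) :=
    hS.of_isClosed_subset isClosed_frontier hS.isClosed.frontier_subset
  have hE := finite_alphaSegments (α := α) hfin
  have hFfin := finite_sampleFeet (S := S) H.r_pos hfin
  have := Measure.nullSingletonClass_hausdorff Plane zero_lt_one
  have hF : μH[1] (sampleFeet r S 𝒳) = 0 := hFfin.measure_zero _
  have hmeas : ∀ e ∈ hE.toFinset, MeasurableSet (nearestFeet S e \ sampleFeet r S 𝒳) := by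
    intro e he
    obtain ⟨x, y, -, rfl⟩ := hE.mem_toFinset.1 he
    exact (isCompact_nearestFeet hSc (isCompact_segment x y)).measurableSet.diff hFfin.measurableSet
  have hdisj := pairwiseDisjoint_nearestFeet H hS.isClosed hnorm h𝒳 hhit hgen
  calc μH[1] (alphaShape α 𝒳) = μH[1] (⋃ e ∈ hE.toFinset, e) := by
        rw [alphaShape_eq_sUnion]; simp
    _ ≤ ∑ e ∈ hE.toFinset, μH[1] e := measure_biUnion_finset_le _ _
    _ ≤ ∑ e ∈ hE.toFinset, ENNReal.ofReal (1 + 300 * m ^ 2) *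
          μH[1] (nearestFeet S e \ sampleFeet r S 𝒳) := by
        refine Finset.sum_le_sum fun e he => ?_
        obtain ⟨x, y, hxy, rfl⟩ := hE.mem_toFinset.1 he
        rw [measure_sdiff_null hF]
        exact hausdorffMeasure_segment_le H hS.isClosed hSc hfr hnorm h𝒳 hhit hxy
    _ = ENNReal.ofReal (1 + 300 * m ^ 2) *
          μH[1] (⋃ e ∈ hE.toFinset, nearestFeet S e \ sampleFeet r S 𝒳) := by
        rw [← Finset.mul_sum, measure_biUnion_finset _ hmeas]
        rwa [hE.coe_toFinset]
    _ ≤ ENNReal.ofReal (1 + 300 * m ^ 2) * μH[1] (frontier S) := by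
        gcongr
        refine iUnion₂_subset fun e _ => ?_
        rintro p ⟨⟨w, ⟨⟨-, hw⟩, -⟩, rfl⟩, -⟩
        exact hw

/-- The orthogonal projection to the tangent line is `1`-Lipschitz, and the image of the frontier
contains an interval of length `r`. -/
theorem hausdorffMeasure_frontier_pos (hr : 0 < r) {p n : Plane} (hn : IsRollingNormal r S p n) :
    0 < μH[1] (frontier S) := by
  have hlip : LipschitzWith 1 fun v : Plane => ⟪v - p, rot n⟫ := by
    refine LipschitzWith.of_dist_le_mul fun v w => ?_
    have e : ⟪v - p, rot n⟫ - ⟪w - p, rot n⟫ = ⟪v - w, rot n⟫ := by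
      rw [← inner_sub_left]; congr 1; abel
    rw [Real.dist_eq, e, dist_eq_norm, NNReal.coe_one, one_mul]
    have := abs_real_inner_le_norm (v - w) (rot n)
    rwa [norm_rot, hn.norm_eq, mul_one] at this
  have hsub : Icc (-(r / 2)) (r / 2) ⊆ (fun v : Plane => ⟪v - p, rot n⟫) '' frontier S := by
    intro u hu
    have hu2 : u ^ 2 ≤ (r / 2) ^ 2 := sq_le_sq' hu.1 hu.2
    have hr2 : 0 < r ^ 2 := by positivity
    have hfp (t : ℝ) : ‖framePoint p n u t - p‖ ^ 2 = u ^ 2 + t ^ 2 := by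
      rw [norm_sq_eq_add hn.norm_eq, inner_framePoint_sub hn.norm_eq,
        inner_framePoint_sub_rot hn.norm_eq]
    have hup : framePoint p n u r ∉ S := by
      intro hmem
      have := hn.inner_le _ (subset_closure hmem)
      rw [hfp, inner_framePoint_sub hn.norm_eq] at this
      nlinarith
    have hdown : framePoint p n u (-r) ∈ S := by
      by_contra hmem
      have := hn.le_inner _ (subset_closure hmem)
      rw [hfp, inner_framePoint_sub hn.norm_eq] at this
      nlinarith
    have hconn : IsPreconnected ((fun t => framePoint p n u t) '' Icc (-r) r) :=
      isPreconnected_Icc.image _ (by fun_prop)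
    obtain ⟨b, ⟨t, ht, rfl⟩, hb⟩ := hconn.exists_mem_frontier
      (mem_image_of_mem _ (left_mem_Icc.2 (by linarith))) hdown
      (mem_image_of_mem _ (right_mem_Icc.2 (by linarith))) hup
    exact ⟨_, hb, inner_framePoint_sub_rot hn.norm_eq u t⟩
  have h1 : (0 : ℝ≥0∞) < volume (Icc (-(r / 2)) (r / 2)) := by
    rw [Real.volume_Icc]; simp; linarith
  have h2 := hlip.hausdorffMeasure_image_le zero_le_one (frontier S)
  rw [hausdorffMeasure_real] at h2
  have h3 := (h1.trans_le (measure_mono hsub)).trans_le h2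
  simpa using h3

theorem exists_finite_hitting (hS : IsCompact S) (hne : S.Nonempty) (hh : 0 < h) :
    ∃ 𝒳 ⊆ S, 𝒳.Finite ∧ ∀ c, Metric.infDist c S ≤ α - h → ∃ q ∈ 𝒳, ‖q - c‖ < α := by
  obtain ⟨𝒳, h𝒳, hfin, hcov⟩ := hS.finite_cover_balls hh
  refine ⟨𝒳, h𝒳, hfin, fun c hc => ?_⟩
  obtain ⟨p, hp, hpd⟩ := hS.exists_infDist_eq_dist hne c
  obtain ⟨q, hq, hpq⟩ := mem_iUnion₂.1 (hcov hp)
  refine ⟨q, hq, ?_⟩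
  rw [← dist_eq_norm]
  rw [Metric.mem_ball] at hpq
  linarith [dist_triangle_left q c p, dist_comm c p]

end LengthComparison
-- Area of the balls to be hit, and nets of centres
section VolumeAndNets

variable {r α m M κ h : ℝ} {S : Set Plane}

/-- The rectangle of tangential half-width `w` and of depths between `a` and `b` below `p`. -/
def frameBox (p n : Plane) (w a b : ℝ) : Set Plane :=
  {z | |⟪z - p, rot n⟫| ≤ w ∧ -⟪z - p, n⟫ ∈ Icc a b}

/-- The coordinates in the frame of a unit vector, as a linear isometry. -/
noncomputable def frameIsometry (n : Plane) (hn : ‖n‖ = 1) : Plane →ₗᵢ[ℝ] Plane where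
  toFun v := !₂[⟪v, rot n⟫, -⟪v, n⟫]
  map_add' v w := by ext i; fin_cases i <;> simp [inner_add_left]; ring
  map_smul' a v := by ext i; fin_cases i <;> simp [inner_smul_left]
  norm_map' v := by
    rw [← sq_eq_sq₀ (norm_nonneg _) (norm_nonneg _), norm_sq_coord, norm_sq_eq_add hn]
    simp

theorem volume_frameBox {p n : Plane} (hn : ‖n‖ = 1) {w a b : ℝ} (hw : 0 ≤ w) :
    volume (frameBox p n w a b) = ENNReal.ofReal (2 * w * (b - a)) := by
  let L : Plane ≃ₗᵢ[ℝ] Plane := (frameIsometry n hn).toLinearIsometryEquiv rfl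
  have hbox : frameBox p n w a b = (fun z => z - p) ⁻¹' (L ⁻¹'
      ((WithLp.ofLp : Plane → Fin 2 → ℝ) ⁻¹' (Icc ![-w, a] ![w, b]))) := by
    ext z
    simp only [frameBox, mem_ofPred_eq, mem_preimage, mem_Icc, Pi.le_def, Fin.forall_fin_two, abs_le]
    change _ ↔ ((-w ≤ ⟪z - p, rot n⟫ ∧ a ≤ -⟪z - p, n⟫) ∧ ⟪z - p, rot n⟫ ≤ w ∧ -⟪z - p, n⟫ ≤ b)
    tauto
  have hm : MeasurableSet (Icc ![-w, a] ![w, b]) := measurableSet_Icc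
  have h0 := EuclideanSpace.volume_preserving_symm_measurableEquiv_toLp (Fin 2)
  have hm' : MeasurableSet ((WithLp.ofLp : Plane → Fin 2 → ℝ) ⁻¹' (Icc ![-w, a] ![w, b])) :=
    h0.measurable hm
  rw [hbox, (measurePreserving_sub_right volume p).measure_preimage
    (L.measurePreserving.measurable hm').nullMeasurableSet,
    L.measurePreserving.measure_preimage hm'.nullMeasurableSet]
  refine (h0.measure_preimage hm.nullMeasurableSet).trans ?_
  rw [Real.volume_Icc_pi, Fin.prod_univ_two]
  simp only [Matrix.cons_val_zero, Matrix.cons_val_one]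
  rw [← ENNReal.ofReal_mul (by linarith)]
  congr 1; ring

/-- Each ball of radius slightly below `α` that reaches into `S` to depth `h / 2` contains a small
rectangle contained in `S`. -/
theorem exists_frameBox_subset (H : RollingScale r α m M κ h) (hS : IsClosed S) (hne : S.Nonempty)
    (hnorm : ∀ p ∈ frontier S, ∃ n, IsRollingNormal r S p n) {c : Plane}
    (hc : Metric.infDist c S ≤ α - h) :
    ∃ p n : Plane, ‖n‖ = 1 ∧
      frameBox p n (κ / (8 * M)) (h / 8) (h / 4) ⊆ Metric.ball c (α - h / 2) ∩ S := by
  have hα := H.pos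
  have hr := H.r_pos
  have hM := H.M_pos
  have hM1 := H.one_le
  have hh := H.h_pos
  have hκ := H.κ_pos
  have hhα : 1000 * h ≤ α := by
    have h1 := H.h_le
    have h2 := H.sq_le
    nlinarith
  set w := κ / (8 * M) with hw
  have hw2 : 16 * w ^ 2 ≤ α * h := by
    have e : 16 * w ^ 2 * M = α * h := by
      rw [hw, div_pow, ← H.depth]; field_simp; ring
    rw [← e]
    nlinarith [sq_nonneg w]
  -- coordinates of the points of the box
  have hbox : ∀ {p n z : Plane}, ‖n‖ = 1 → z ∈ frameBox p n w (h / 8) (h / 4) →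
      16 * ⟪z - p, rot n⟫ ^ 2 ≤ α * h := by
    intro p n z hn hz
    have := sq_le_sq' (abs_le.1 hz.1).1 (abs_le.1 hz.1).2
    linarith
  have hmem : ∀ {p n z : Plane}, IsRollingNormal r S p n →
      z ∈ frameBox p n w (h / 8) (h / 4) → z ∈ S := by
    intro p n z hn hz
    by_contra hzS
    have h1 := hn.le_inner z (subset_closure hzS)
    rw [norm_sq_eq_add hn.norm_eq] at h1
    have h2 := hbox hn.norm_eq hz
    obtain ⟨-, h3, h4⟩ := hz
    have h5 : α * h ≤ r * h := by have := H.lt; gcongr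
    have h6 : r * (h / 8) ≤ r * -⟪z - p, n⟫ := by gcongr
    have h7 : ⟪z - p, n⟫ ^ 2 ≤ r * -⟪z - p, n⟫ := by nlinarith [H.lt]
    nlinarith [mul_pos hr hh]
  have hnear : ∀ {p n z : Plane}, ‖n‖ = 1 → z ∈ frameBox p n w (h / 8) (h / 4) →
      ‖z - p‖ < α / 4 := by
    intro p n z hn hz
    have h2 := hbox hn hz
    obtain ⟨-, h3, h4⟩ := hz
    refine (sq_lt_sq₀ (norm_nonneg _) (by positivity)).1 ?_
    rw [norm_sq_eq_add hn]
    nlinarith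
  by_cases hcS : c ∈ S
  -- Three cases: near a frontier point the box hangs below that point; deep inside `S` any frame at
  -- `c` will do; outside `S` the box hangs below the nearest point.
  · by_cases hfr : ∃ p ∈ frontier S, ‖p - c‖ < α / 4
    · obtain ⟨p, hp, hpc⟩ := hfr
      obtain ⟨n, hn⟩ := hnorm p hp
      refine ⟨p, n, hn.norm_eq, fun z hz => ⟨?_, hmem hn hz⟩⟩
      have h1 := hnear hn.norm_eq hz
      rw [Metric.mem_ball, dist_eq_norm]
      have e : z - c = (z - p) + (p - c) := by abel
      rw [e]
      refine (norm_add_le _ _).trans_lt ?_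
      linarith
    · push Not at hfr
      have hn : ‖(!₂[1, 0] : Plane)‖ = 1 := by
        rw [← sq_eq_sq₀ (norm_nonneg _) zero_le_one, norm_sq_coord]; simp
      refine ⟨c, !₂[1, 0], hn, fun z hz => ?_⟩
      have h1 := hnear hn hz
      refine ⟨by rw [Metric.mem_ball, dist_eq_norm]; linarith, ?_⟩
      by_contra hzS
      obtain ⟨y, hy, hyS⟩ := (convex_ball c (α / 4)).isPreconnected.exists_mem_frontier
        (Metric.mem_ball_self (by linarith)) hcS (by rwa [Metric.mem_ball, dist_eq_norm]) hzS
      rw [Metric.mem_ball, dist_eq_norm] at hy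
      exact absurd (hfr y hyS) hy.not_ge
  · obtain ⟨p, hpS, hcp⟩ := hS.exists_infDist_eq_dist hne c
    have hpos : 0 < dist c p := dist_pos.2 fun h => hcS (h ▸ hpS)
    obtain ⟨hp, hball⟩ := mem_frontier_of_nearest hpS hcp hpos
    obtain ⟨n, hn⟩ := hnorm p hp
    have hceq := hn.eq_add_smul_of_ball_inter hr hpos.le (dist_eq_norm c p).symm hball
    refine ⟨p, n, hn.norm_eq, fun z hz => ⟨?_, hmem hn hz⟩⟩
    have h2 := hbox hn.norm_eq hz
    obtain ⟨-, h3, h4⟩ := hz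
    have hcf : c = framePoint p n 0 (dist c p) := by
      rw [framePoint, zero_smul, add_zero]; exact hceq
    rw [Metric.mem_ball, dist_eq_norm]
    refine (sq_lt_sq₀ (norm_nonneg _) (by linarith)).1 ?_
    rw [hcf, norm_sub_framePoint_sq hn.norm_eq, sub_zero]
    rw [hcp] at hc
    -- The centre is at height at most `α - h` and the box at depth at most `h / 4`. Replacing `3 /
    -- 4 * h` by `h / 2` leaves room for the half-width of the box.
    have h5 : (⟪z - p, n⟫ - dist c p) ^ 2 ≤ (α - 3 / 4 * h) ^ 2 := by
      apply sq_le_sq' <;> linarith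
    nlinarith [mul_pos hα hh]

theorem volume_ball_inter_ge (H : RollingScale r α m M κ h) (hS : IsClosed S) (hne : S.Nonempty)
    (hnorm : ∀ p ∈ frontier S, ∃ n, IsRollingNormal r S p n) {c : Plane}
    (hc : Metric.infDist c S ≤ α - h) :
    ENNReal.ofReal (h * κ / (32 * M)) ≤ volume (Metric.ball c (α - h / 2) ∩ S) := by
  obtain ⟨p, n, hn, hsub⟩ := exists_frameBox_subset H hS hne hnorm hc
  refine le_trans (le_of_eq ?_) (measure_mono hsub)
  have := H.κ_pos
  have := H.M_pos
  rw [volume_frameBox hn (by positivity)]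
  congr 1
  field_simp; ring

/-- A bounded set in the plane has a net of quadratic size in its own points. -/
theorem exists_finset_net {D : Set Plane} {x₀ : Plane} {R ε : ℝ} (hε : 0 < ε) (hR : 0 ≤ R)
    (hD : ∀ c ∈ D, ‖c - x₀‖ ≤ R) :
    ∃ T : Finset Plane, (∀ t ∈ T, t ∈ D) ∧ (∀ c ∈ D, ∃ t ∈ T, ‖t - c‖ < 2 * ε) ∧
      (T.card : ℝ) ≤ (2 * R / ε + 3) ^ 2 := by
  classical
  let g : Plane → ℤ × ℤ := fun c => (⌊(c - x₀) 0 / ε⌋, ⌊(c - x₀) 1 / ε⌋)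
  let N : ℤ := ⌈R / ε⌉
  let G : Finset (ℤ × ℤ) := Finset.Icc (-N) N ×ˢ Finset.Icc (-N) N
  have hN : 0 ≤ N := Int.ceil_nonneg (by positivity)
  have hcoord : ∀ c ∈ D, ∀ i, ⌊(c - x₀) i / ε⌋ ∈ Finset.Icc (-N) N := by
    intro c hc i
    have h1 : |(c - x₀) i| ≤ R := (PiLp.norm_apply_le (c - x₀) i).trans (hD c hc)
    have h2 : R / ε ≤ N := Int.le_ceil _
    have h3 : |(c - x₀) i / ε| ≤ N := by
      rw [abs_div, abs_of_pos hε]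
      exact (div_le_div_of_nonneg_right h1 hε.le).trans h2
    rw [Finset.mem_Icc]
    constructor
    · rw [Int.le_floor]; push_cast; exact (abs_le.1 h3).1
    · exact Int.cast_le.1 ((Int.floor_le _).trans (abs_le.1 h3).2)
  have hg : ∀ c ∈ D, g c ∈ G := fun c hc => Finset.mem_product.2 ⟨hcoord c hc 0, hcoord c hc 1⟩
  have hcell : ∀ c c', g c = g c' → ‖c - c'‖ < 2 * ε := by
    intro c c' he
    have hi : ∀ i, ⌊(c - x₀) i / ε⌋ = ⌊(c' - x₀) i / ε⌋ → |(c - c') i| < ε := by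
      intro i hfl
      have := Int.abs_sub_lt_one_of_floor_eq_floor hfl
      rw [← sub_div, abs_div, abs_of_pos hε, div_lt_one hε] at this
      simpa using this
    have h0 := hi 0 (congrArg Prod.fst he)
    have h1 := hi 1 (congrArg Prod.snd he)
    refine (sq_lt_sq₀ (norm_nonneg _) (by positivity)).1 ?_
    rw [norm_sq_coord]
    have h0' := sq_lt_sq' (abs_lt.1 h0).1 (abs_lt.1 h0).2
    have h1' := sq_lt_sq' (abs_lt.1 h1).1 (abs_lt.1 h1).2
    nlinarith
  -- Each grid cell is represented by a point of `D` itself, because the area bound holds only for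
  -- centres in `D`.
  let rep : ℤ × ℤ → Plane := fun k => if hk : ∃ c ∈ D, g c = k then hk.choose else x₀
  have hrep : ∀ c ∈ D, rep (g c) ∈ D ∧ g (rep (g c)) = g c := by
    intro c hc
    have hk : ∃ c' ∈ D, g c' = g c := ⟨c, hc, rfl⟩
    simp only [rep, dif_pos hk]
    exact hk.choose_spec
  refine ⟨(G.image rep).filter (· ∈ D), fun t ht => (Finset.mem_filter.1 ht).2, ?_, ?_⟩
  · intro c hc
    exact ⟨rep (g c), Finset.mem_filter.2 ⟨Finset.mem_image_of_mem _ (hg c hc), (hrep c hc).1⟩,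
      hcell _ _ (hrep c hc).2⟩
  · have h1 : ((G.image rep).filter (· ∈ D)).card ≤ G.card :=
      (Finset.card_filter_le _ _).trans Finset.card_image_le
    have h2 : (G.card : ℝ) = (2 * N + 1) ^ 2 := by
      have h3 : ((Finset.Icc (-N) N).card : ℤ) = 2 * N + 1 := by
        rw [Int.card_Icc_of_le] <;> omega
      have h4 : ((Finset.Icc (-N) N).card : ℝ) = 2 * N + 1 := by exact_mod_cast h3
      rw [Finset.card_product, Nat.cast_mul, h4]; ring
    have h3 : (N : ℝ) ≤ R / ε + 1 := (Int.ceil_lt_add_one _).le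
    have h4 : (0 : ℝ) ≤ N := by exact_mod_cast hN
    calc (((G.image rep).filter (· ∈ D)).card : ℝ) ≤ G.card := by exact_mod_cast h1
      _ = (2 * N + 1) ^ 2 := h2
      _ ≤ (2 * R / ε + 3) ^ 2 := by
        have : 2 * R / ε = 2 * (R / ε) := by ring
        exact pow_le_pow_left₀ (by linarith) (by linarith) 2

end VolumeAndNets
-- General position and missed sets for a uniform sample
section RandomSample

variable {r α m M κ h : ℝ} {S : Set Plane}

theorem finite_centers {x y : Plane} (hxy : x ≠ y) (α : ℝ) :
    {c : Plane | ‖x - c‖ = α ∧ ‖y - c‖ = α}.Finite := by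
  by_cases hs : {c : Plane | ‖x - c‖ = α ∧ ‖y - c‖ = α}.Subsingleton
  · exact hs.finite
  · rw [Set.not_subsingleton_iff] at hs
    obtain ⟨c, ⟨hc, hc'⟩, c', ⟨hd, hd'⟩, hne⟩ := hs
    refine (Set.toFinite {c, c'}).subset ?_
    rintro p ⟨hp, hp'⟩
    exact EuclideanGeometry.eq_of_dist_eq_of_dist_eq_of_finrank_eq_two (by simp) hxy hne
      (by rw [dist_comm, dist_eq_norm, hc]) (by rw [dist_comm, dist_eq_norm, hd])
      (by rw [dist_comm, dist_eq_norm, hp]) (by rw [dist_comm, dist_eq_norm, hc'])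
      (by rw [dist_comm, dist_eq_norm, hd']) (by rw [dist_comm, dist_eq_norm, hp'])

/-- Triples of points on a common circle of radius `α`, the first two being distinct. -/
def cocircularTriples (α : ℝ) : Set ((Plane × Plane) × Plane) :=
  {w | w.1.1 ≠ w.1.2 ∧ ∃ c, ‖w.1.1 - c‖ = α ∧ ‖w.1.2 - c‖ = α ∧ ‖w.2 - c‖ = α}

/-- Writing the centre as the first point plus a vector of the compact circle of radius `α` turns
the existential into a projection along a compact factor, which is closed. -/
theorem measurableSet_cocircularTriples (α : ℝ) : MeasurableSet (cocircularTriples α) := by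
  have h1 : IsOpen {w : (Plane × Plane) × Plane | w.1.1 ≠ w.1.2} :=
    isOpen_ne_fun (by fun_prop) (by fun_prop)
  have h2 : IsClosed {w : (Plane × Plane) × Plane |
      ∃ c, ‖w.1.1 - c‖ = α ∧ ‖w.1.2 - c‖ = α ∧ ‖w.2 - c‖ = α} := by
    let C := Metric.sphere (0 : Plane) α
    have : CompactSpace C := isCompact_iff_compactSpace.1 (isCompact_sphere _ _)
    have h3 : IsClosed {v : C × ((Plane × Plane) × Plane) |
        ‖v.2.1.2 - (v.2.1.1 + v.1)‖ = α ∧ ‖v.2.2 - (v.2.1.1 + v.1)‖ = α} :=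
      (isClosed_eq (by fun_prop) continuous_const).inter (isClosed_eq (by fun_prop) continuous_const)
    convert isClosedMap_snd_of_compactSpace _ h3 using 1
    ext w
    constructor
    · rintro ⟨c, hc1, hc2, hc3⟩
      refine ⟨(⟨c - w.1.1, by rw [mem_sphere_zero_iff_norm, norm_sub_rev, hc1]⟩, w), ⟨?_, ?_⟩, rfl⟩
      · simpa using hc2
      · simpa using hc3
    · rintro ⟨⟨⟨e, he⟩, w'⟩, ⟨hw1, hw2⟩, rfl⟩
      refine ⟨w'.1.1 + e, ?_, hw1, hw2⟩
      rw [mem_sphere_zero_iff_norm] at he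
      simp [he]
  exact h1.measurableSet.inter h2.measurableSet

/-- Two distinct points lie on finitely many common circles of radius `α`, each of them null. -/
theorem measure_cocircular_section {μ : Measure Plane} (hμ : μ ≪ volume) (hα : 0 < α)
    (v : Plane × Plane) : μ (Prod.mk v ⁻¹' cocircularTriples α) = 0 := by
  by_cases hv : v.1 = v.2
  · have : Prod.mk v ⁻¹' cocircularTriples α = ∅ := by
      rw [Set.eq_empty_iff_forall_notMem]
      rintro z ⟨hne, -⟩
      exact hne hv
    rw [this, measure_empty]
  · refine measure_mono_null (t := ⋃ c ∈ {c : Plane | ‖v.1 - c‖ = α ∧ ‖v.2 - c‖ = α},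
      Metric.sphere c α) ?_ ?_
    · rintro z ⟨-, c, h1, h2, h3⟩
      exact mem_biUnion (x := c) ⟨h1, h2⟩ (by rw [Metric.mem_sphere, dist_eq_norm]; exact h3)
    · rw [measure_biUnion_null_iff (finite_centers hv α).countable]
      intro c _
      exact hμ (Measure.addHaar_sphere_of_ne_zero _ _ hα.ne')

theorem ae_mem_of_isUniformSample {Ω ι : Type*} [MeasurableSpace Ω] {P : Measure Ω} [Countable ι]
    {X : ι → Ω → Plane} (hS : MeasurableSet S)
    (hX : IsUniformSample P S X) : ∀ᵐ ω ∂P, ∀ i, X i ω ∈ S := by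
  rw [ae_all_iff]
  intro i
  obtain ⟨hm, hu, -⟩ := hX
  have h1 : P.map (X i) Sᶜ = 0 := by
    rw [hu i, cond_apply hS]; simp
  rw [Measure.map_apply (hm i) hS.compl] at h1
  exact h1

variable {Ω : Type*} [MeasurableSpace Ω] {P : Measure Ω} [IsProbabilityMeasure P]
  {ι : Type*} {X : ι → Ω → Plane}

/-- Fubini applies because the third point is independent of the pair; `i = j` is harmless, as the
set requires the first two points to differ. -/
theorem measure_cocircular (hα : 0 < α) (hX : IsUniformSample P S X) {i j k : ι} (hik : i ≠ k)
    (hjk : j ≠ k) : P {ω | ((X i ω, X j ω), X k ω) ∈ cocircularTriples α} = 0 := by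
  obtain ⟨hm, hu, hind⟩ := hX
  have h1 := hind.indepFun_prodMk hm i j k hik hjk
  have hpair : Measurable fun ω => (X i ω, X j ω) := (hm i).prodMk (hm j)
  have h2 := (indepFun_iff_map_prod_eq_prod_map_map hpair.aemeasurable (hm k).aemeasurable).1 h1
  have h3 := Measure.map_apply (μ := P) (hpair.prodMk (hm k)) (measurableSet_cocircularTriples α)
  have hac : P.map (X k) ≪ volume := (hu k).absolutelyContinuous
  rw [h2, Measure.measure_prod_null (measurableSet_cocircularTriples α) |>.2] at h3
  · exact h3.symm
  · exact Eventually.of_forall fun v => measure_cocircular_section hac hα v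

theorem ae_inGeneralPosition [Countable ι] (hα : 0 < α) (hX : IsUniformSample P S X) :
    ∀ᵐ ω ∂P, InGeneralPosition α (range fun i => X i ω) := by
  have h1 : ∀ᵐ ω ∂P, ∀ i j k, i ≠ k → j ≠ k →
      ((X i ω, X j ω), X k ω) ∉ cocircularTriples α := by
    simp only [ae_all_iff]
    intro i j k hik hjk
    rw [ae_iff]
    simpa using measure_cocircular hα hX hik hjk
  filter_upwards [h1] with ω hω
  rintro _ ⟨i, rfl⟩ _ ⟨j, rfl⟩ _ ⟨k, rfl⟩ hij hki hkj c hc1 hc2 hc3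
  refine hω i j k ?_ ?_ ⟨hij, c, hc1, hc2, hc3⟩
  · rintro rfl; exact hki rfl
  · rintro rfl; exact hkj rfl

/-- The probability that a sample misses a set of at least a fixed volume inside `S`. -/
theorem measure_forall_notMem_le {n : ℕ} {X : Fin n → Ω → Plane} (hS : MeasurableSet S)
    (hX : IsUniformSample P S X) {B : Set Plane} (hB : MeasurableSet B) {v V : ℝ} (hV : 0 < V)
    (hv : ENNReal.ofReal v ≤ volume (B ∩ S)) (hSV : volume S ≤ ENNReal.ofReal V) :
    P {ω | ∀ i, X i ω ∉ B} ≤ ENNReal.ofReal (Real.exp (-(n * (v / V)))) := by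
  obtain ⟨hm, hu, hind⟩ := hX
  have hone : ∀ i, P (X i ⁻¹' Bᶜ) ≤ ENNReal.ofReal (Real.exp (-(v / V))) := by
    intro i
    have h1 : ENNReal.ofReal (v / V) ≤ P (X i ⁻¹' B) := by
      rw [← Measure.map_apply (hm i) hB, hu i, cond_apply hS, inter_comm,
        ENNReal.ofReal_div_of_pos hV, ENNReal.div_eq_inv_mul]
      gcongr
    rw [preimage_compl, prob_compl_eq_one_sub (hm i hB)]
    calc 1 - P (X i ⁻¹' B) ≤ 1 - ENNReal.ofReal (v / V) := tsub_le_tsub_left h1 1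
      _ ≤ ENNReal.ofReal (1 - v / V) := by
        rw [← ENNReal.ofReal_one]
        rcases le_total 0 (v / V) with h | h
        · rw [ENNReal.ofReal_sub _ h]
        · rw [ENNReal.ofReal_of_nonpos h, tsub_zero]
          exact ENNReal.ofReal_le_ofReal (by linarith)
      _ ≤ _ := ENNReal.ofReal_le_ofReal (by linarith [Real.add_one_le_exp (-(v / V))])
  have h2 : {ω | ∀ i, X i ω ∉ B} = ⋂ i ∈ (Finset.univ : Finset (Fin n)), X i ⁻¹' Bᶜ := by
    ext ω; simp
  rw [h2, hind.measure_inter_preimage_eq_mul Finset.univ fun i _ => hB.compl]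
  calc ∏ i, P (X i ⁻¹' Bᶜ) ≤ ∏ _i : Fin n, ENNReal.ofReal (Real.exp (-(v / V))) :=
        Finset.prod_le_prod' fun i _ => hone i
    _ = ENNReal.ofReal (Real.exp (-(n * (v / V)))) := by
        rw [Finset.prod_const, Finset.card_univ, Fintype.card_fin,
          ← ENNReal.ofReal_pow (Real.exp_pos _).le, ← Real.exp_nat_mul]
        congr 2; ring

end RandomSample
-- Tail bound
section Concentration

variable {r α m M κ h : ℝ} {S : Set Plane}

theorem frontier_nonempty_of_isCompact (hS : IsCompact S) (hne : S.Nonempty) :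
    (frontier S).Nonempty :=
  nonempty_frontier_iff.2 ⟨hne, hS.ne_univ⟩

theorem rollingScale_mk (hα : 0 < α) (hαr : α < r) (hm : 0 < m) (hm1 : 1000 * m ≤ 1) :
    RollingScale r α m (r / (r - α)) (m * α / (r / (r - α)))
      ((m * α / (r / (r - α))) ^ 2 / (4 * α * (r / (r - α)))) := by
  have h1 : 0 < r - α := by linarith
  have h2 : 0 < r := by linarith
  have hM : 0 < r / (r - α) := by positivity
  exact ⟨hα, hαr, div_mul_cancel₀ _ h1.ne', hm, hm1, mul_div_cancel₀ _ hM.ne',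
    mul_div_cancel₀ _ (by positivity)⟩

/-- Finiteness follows from the deterministic comparison, applied to a finite `h`-net of `S` in
place of a random sample. -/
theorem hausdorffMeasure_frontier_pos_lt_top (hα : 0 < α) (hαr : α < r) (hS : IsCompact S)
    (hne : S.Nonempty) (hnorm : ∀ p ∈ frontier S, ∃ n, IsRollingNormal r S p n) :
    0 < μH[1] (frontier S) ∧ μH[1] (frontier S) < ⊤ := by
  obtain ⟨p, hp⟩ := frontier_nonempty_of_isCompact hS hne
  obtain ⟨n, hn⟩ := hnorm p hp
  refine ⟨hausdorffMeasure_frontier_pos (hα.trans hαr) hn, ?_⟩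
  have H := rollingScale_mk (m := 1 / 1000) hα hαr (by norm_num) (by norm_num)
  obtain ⟨𝒳, h𝒳, hfin, hhit⟩ := exists_finite_hitting (α := α) hS hne H.h_pos
  exact (hausdorffMeasure_frontier_le H hnorm hfin h𝒳 hhit).trans_lt
    (ENNReal.mul_lt_top ENNReal.ofReal_lt_top (hausdorffMeasure_alphaShape_lt_top hfin))

theorem abs_length_ratio_sub_one_le (H : RollingScale r α m M κ h) (hS : IsCompact S)
    (hne : S.Nonempty) (hnorm : ∀ p ∈ frontier S, ∃ n, IsRollingNormal r S p n) {𝒳 : Set Plane}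
    (hfin : 𝒳.Finite) (h𝒳 : 𝒳 ⊆ S)
    (hhit : ∀ c, Metric.infDist c S ≤ α - h → ∃ q ∈ 𝒳, ‖q - c‖ < α)
    (hgen : InGeneralPosition α 𝒳) :
    |(μH[1] (alphaShape α 𝒳)).toReal / (μH[1] (frontier S)).toReal - 1| ≤ 300 * m ^ 2 := by
  obtain ⟨hpos, hlt⟩ := hausdorffMeasure_frontier_pos_lt_top H.pos H.lt hS hne hnorm
  have h1 := hausdorffMeasure_frontier_le H hnorm hfin h𝒳 hhit
  have h2 := hausdorffMeasure_alphaShape_le H hS (frontier_nonempty_of_isCompact hS hne) hnorm hfin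
    h𝒳 hhit hgen
  have h3 := hausdorffMeasure_alphaShape_lt_top (α := α) hfin
  have hK : 0 ≤ 1 + 300 * m ^ 2 := by positivity
  have h1' := ENNReal.toReal_mono (ENNReal.mul_lt_top ENNReal.ofReal_lt_top h3).ne h1
  have h2' := ENNReal.toReal_mono (ENNReal.mul_lt_top ENNReal.ofReal_lt_top hlt).ne h2
  rw [ENNReal.toReal_mul, ENNReal.toReal_ofReal hK] at h1' h2'
  have hL := ENNReal.toReal_pos hpos.ne' hlt.ne
  set L := (μH[1] (frontier S)).toReal
  set C := (μH[1] (alphaShape α 𝒳)).toReal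
  have hC : 0 ≤ C := ENNReal.toReal_nonneg
  have hC' : C / L ≤ 1 + 300 * m ^ 2 := (div_le_iff₀ hL).2 h2'
  have hC'' : 1 - 300 * m ^ 2 ≤ C / L := by
    rw [le_div_iff₀ hL]
    nlinarith [sq_nonneg (300 * m ^ 2), mul_nonneg (sq_nonneg m) hL.le]
  rw [abs_le]
  constructor <;> linarith

variable {Ω : Type*} [MeasurableSpace Ω] {P : Measure Ω} [IsProbabilityMeasure P] {n : ℕ}
  {X : Fin n → Ω → Plane}

theorem volume_le_of_diam_le (hS : IsCompact S) (hne : S.Nonempty) {d : ℝ} (hd0 : 0 ≤ d)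
    (hd : Metric.diam S ≤ d) : volume S ≤ ENNReal.ofReal (Real.pi * d ^ 2) := by
  obtain ⟨x₀, hx₀⟩ := hne
  have hsub : S ⊆ Metric.closedBall x₀ d := fun x hx =>
    (Metric.dist_le_diam_of_mem hS.isBounded hx hx₀).trans hd
  refine (measure_mono hsub).trans (le_of_eq ?_)
  rw [EuclideanSpace.volume_closedBall_fin_two, ENNReal.ofReal_mul Real.pi_pos.le,
    ENNReal.ofReal_pow hd0, mul_comm]

/-- The probability that some ball of radius `α` entering `S` to depth `h` misses the sample. -/
theorem measure_not_hitting_le (H : RollingScale r α m M κ h) (hS : IsCompact S)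
    (hne : S.Nonempty) (hnorm : ∀ p ∈ frontier S, ∃ n, IsRollingNormal r S p n)
    (hX : IsUniformSample P S X) {d : ℝ} (hd0 : 0 < d) (hd : Metric.diam S ≤ d) :
    P {ω | ¬ ∀ c, Metric.infDist c S ≤ α - h → ∃ q ∈ range fun i => X i ω, ‖q - c‖ < α} ≤
      ENNReal.ofReal ((8 * (d + α) / h + 3) ^ 2 *
        Real.exp (-(n * (h * κ / (32 * M) / (Real.pi * d ^ 2))))) := by
  have hα := H.pos
  have hh := H.h_pos
  obtain ⟨x₀, hx₀⟩ := id hne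
  -- Mesh `h / 4` puts each centre within `h / 2` of the net, so a missed ball of radius `α`
  -- contains a missed ball of radius `α - h / 2` about a net point.
  obtain ⟨T, hTD, hTnet, hTcard⟩ := exists_finset_net
    (D := {c | Metric.infDist c S ≤ α - h}) (x₀ := x₀) (R := d + α) (ε := h / 4)
    (by positivity) (by positivity) (by
      intro c hc
      rw [mem_ofPred_eq] at hc
      obtain ⟨p, hp, hcp⟩ := hS.exists_infDist_eq_dist hne c
      have h1 := (Metric.dist_le_diam_of_mem hS.isBounded hp hx₀).trans hd
      have h2 := dist_triangle c p x₀
      rw [← dist_eq_norm]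
      linarith)
  set E := Real.exp (-(n * (h * κ / (32 * M) / (Real.pi * d ^ 2)))) with hE
  have hsub : {ω | ¬ ∀ c, Metric.infDist c S ≤ α - h → ∃ q ∈ range fun i => X i ω, ‖q - c‖ < α} ⊆
      ⋃ t ∈ T, {ω | ∀ i, X i ω ∉ Metric.ball t (α - h / 2)} := by
    intro ω hω
    rw [mem_ofPred_eq] at hω
    push Not at hω
    obtain ⟨c, hc, hmiss⟩ := hω
    obtain ⟨t, ht, htc⟩ := hTnet c hc
    refine mem_biUnion ht fun i hi => ?_
    rw [Metric.mem_ball, dist_eq_norm] at hi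
    have h1 := hmiss (X i ω) (mem_range_self i)
    have h2 : X i ω - c = (X i ω - t) + (t - c) := by abel
    have h3 := norm_add_le (X i ω - t) (t - c)
    rw [← h2] at h3
    linarith
  calc P _ ≤ P (⋃ t ∈ T, {ω | ∀ i, X i ω ∉ Metric.ball t (α - h / 2)}) := measure_mono hsub
    _ ≤ ∑ t ∈ T, P {ω | ∀ i, X i ω ∉ Metric.ball t (α - h / 2)} := measure_biUnion_finset_le _ _
    _ ≤ ∑ _t ∈ T, ENNReal.ofReal E := by
      refine Finset.sum_le_sum fun t ht => ?_
      exact measure_forall_notMem_le hS.measurableSet hX measurableSet_ball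
        (by have := Real.pi_pos; positivity)
        (volume_ball_inter_ge H hS.isClosed hne hnorm (hTD t ht))
        (volume_le_of_diam_le hS hne hd0.le hd)
    _ = ENNReal.ofReal (T.card * E) := by
      rw [Finset.sum_const, nsmul_eq_mul, ENNReal.ofReal_mul (Nat.cast_nonneg _),
        ENNReal.ofReal_natCast]
    _ ≤ _ := by
      apply ENNReal.ofReal_le_ofReal
      have e : 2 * (d + α) / (h / 4) = 8 * (d + α) / h := by field_simp; ring
      rw [← e]
      exact mul_le_mul_of_nonneg_right hTcard (Real.exp_pos _).le

theorem measure_length_ratio_le_of_scale (H : RollingScale r α m M κ h) (hS : IsCompact S)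
    (hne : S.Nonempty) (hnorm : ∀ p ∈ frontier S, ∃ n, IsRollingNormal r S p n)
    (hX : IsUniformSample P S X) {d : ℝ} (hd0 : 0 < d) (hd : Metric.diam S ≤ d) :
    P {ω | 300 * m ^ 2 < |(μH[1] (alphaShape α (range fun i => X i ω))).toReal /
        (μH[1] (frontier S)).toReal - 1|} ≤
      ENNReal.ofReal ((8 * (d + α) / h + 3) ^ 2 *
        Real.exp (-(n * (h * κ / (32 * M) / (Real.pi * d ^ 2))))) := by
  refine (measure_mono_ae ?_).trans (measure_not_hitting_le H hS hne hnorm hX hd0 hd)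
  filter_upwards [ae_inGeneralPosition H.pos hX, ae_mem_of_isUniformSample hS.measurableSet hX]
    with ω hgen hmem hω hhit
  refine absurd (abs_length_ratio_sub_one_le H hS hne hnorm (finite_range _)
    (range_subset_iff.2 hmem) hhit hgen) (not_le.2 hω)

/-- The tail bound with explicit constants. -/
theorem measure_length_ratio_le (hα : 0 < α) (hαr : α < r) (hS : IsCompact S)
    (hne : S.Nonempty) (hnorm : ∀ p ∈ frontier S, ∃ n, IsRollingNormal r S p n)
    (hX : IsUniformSample P S X) {d : ℝ} (hd0 : 0 < d) (hd : Metric.diam S ≤ d) {M t : ℝ}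
    (hM : M = r / (r - α)) (ht0 : 0 < t) (ht : t ≤ 3 / 10000) :
    P {ω | t < |(μH[1] (alphaShape α (range fun i => X i ω))).toReal /
        (μH[1] (frontier S)).toReal - 1|} ≤
      ENNReal.ofReal (((8 * (d + α) + 3 * α) * (1200 * M ^ 3 / α)) ^ 2 / t ^ 2 *
        Real.exp (-(n * (t ^ (3 / 2 : ℝ) *
          (α ^ 2 / (128 * M ^ 5 * 300 ^ (3 / 2 : ℝ) * (Real.pi * d ^ 2))))))) := by
  -- This makes `300 * m ^ 2 = t`; the bound `3 / 10000` on `t` is exactly `1000 * m ≤ 1`.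
  set m := √(t / 300) with hm
  have hm0 : 0 < m := Real.sqrt_pos.2 (by positivity)
  have hm2 : m ^ 2 = t / 300 := Real.sq_sqrt (by positivity)
  have hm3 : m ^ 3 = t ^ (3 / 2 : ℝ) / 300 ^ (3 / 2 : ℝ) := by
    rw [← Real.div_rpow ht0.le (by norm_num), hm, Real.sqrt_eq_rpow, ← Real.rpow_natCast,
      ← Real.rpow_mul (by positivity)]
    norm_num
  have hm1 : 1000 * m ≤ 1 := by
    have : m ^ 2 ≤ (1 / 1000) ^ 2 := by rw [hm2]; linarith
    have := (sq_le_sq₀ hm0.le (by norm_num)).1 this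
    linarith
  have H := rollingScale_mk hα hαr hm0 hm1
  rw [← hM] at H
  have hMpos := H.M_pos
  have hpi := Real.pi_pos
  have h1 := measure_length_ratio_le_of_scale H hS hne hnorm hX hd0 hd
  rw [show 300 * m ^ 2 = t by rw [hm2]; ring] at h1
  refine h1.trans (ENNReal.ofReal_le_ofReal ?_)
  have hh : (m * α / M) ^ 2 / (4 * α * M) = t * α / (1200 * M ^ 3) := by
    have : (m * α / M) ^ 2 / (4 * α * M) = m ^ 2 * α / (4 * M ^ 3) := by field_simp
    rw [this, hm2]; field_simp; ring
  have hv : (m * α / M) ^ 2 / (4 * α * M) * (m * α / M) / (32 * M) / (Real.pi * d ^ 2) =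
      t ^ (3 / 2 : ℝ) * (α ^ 2 / (128 * M ^ 5 * 300 ^ (3 / 2 : ℝ) * (Real.pi * d ^ 2))) := by
    have : (m * α / M) ^ 2 / (4 * α * M) * (m * α / M) / (32 * M) / (Real.pi * d ^ 2) =
        m ^ 3 * (α ^ 2 / (128 * M ^ 5 * (Real.pi * d ^ 2))) := by field_simp; ring
    rw [this, hm3]
    have h300 : (0 : ℝ) < 300 ^ (3 / 2 : ℝ) := by positivity
    field_simp
  have hhα := H.h_le
  rw [hv]
  refine mul_le_mul_of_nonneg_right ?_ (Real.exp_pos _).le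
  have hpos := H.h_pos
  set k := (m * α / M) ^ 2 / (4 * α * M)
  have hkα : k ≤ α := by nlinarith [H.sq_le]
  rw [← div_pow]
  have e : (8 * (d + α) + 3 * α) * (1200 * M ^ 3 / α) / t = (8 * (d + α) + 3 * α) / k := by
    rw [hh]; field_simp
  rw [e]
  refine pow_le_pow_left₀ (by positivity) ?_ 2
  rw [add_div]
  have : 3 ≤ 3 * α / k := by rw [le_div_iff₀ hpos]; linarith
  linarith

/-- If `n * t ^ (3 / 2) ≤ 1`, the right side is at least `1` because `2 ≤ A`. Otherwise `1 < n ^ 2 *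
t ^ 3 ≤ n ^ 2 * t ^ 2`, so `n ^ 2` absorbs `1 / t ^ 2`. -/
theorem exp_tail_le {D₁ D₂ A t p : ℝ} {n : ℕ} (hn : 1 ≤ n) (ht0 : 0 ≤ t) (ht1 : t ≤ 1)
    (hD₂ : 0 < D₂) (hA2 : 2 ≤ A) (hA₁ : D₁ ≤ A) (hA₂ : 1 / D₂ ≤ A) (hp : p ≤ 1)
    (hpt : 0 < t → p ≤ D₁ / t ^ 2 * Real.exp (-(n * (t ^ (3 / 2 : ℝ) * D₂)))) :
    p ≤ A * (n : ℝ) ^ 2 * Real.exp (-((n : ℝ) * t ^ (3 / 2 : ℝ) / A)) := by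
  have hA : 0 < A := by linarith
  have hn1 : (1 : ℝ) ≤ n := by exact_mod_cast hn
  set τ := t ^ (3 / 2 : ℝ) with hτ
  have hτ0 : 0 ≤ τ := Real.rpow_nonneg ht0 _
  have hτ2 : τ ^ 2 = t ^ 3 := by
    rw [hτ, ← Real.rpow_natCast, ← Real.rpow_mul ht0]
    norm_num
  rcases le_or_gt (n * τ) 1 with hle | hgt
  · refine hp.trans ?_
    have h1 : 1 / 2 ≤ Real.exp (-(n * τ / A)) := by
      have h2 : n * τ / A ≤ 1 / 2 := by
        rw [div_le_iff₀ hA]; linarith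
      linarith [Real.add_one_le_exp (-(n * τ / A))]
    have h3 : 2 ≤ A * (n : ℝ) ^ 2 := by nlinarith
    nlinarith
  · have ht : 0 < t := by
      rcases ht0.eq_or_lt with h | h
      · rw [hτ, ← h, Real.zero_rpow (by norm_num)] at hgt
        linarith
      · exact h
    refine (hpt ht).trans ?_
    have h1 : 1 ≤ (n : ℝ) ^ 2 * t ^ 2 := by
      have h2 : 1 < ((n : ℝ) * τ) ^ 2 := one_lt_pow₀ hgt (by norm_num)
      rw [mul_pow, hτ2] at h2
      have h3 : t ^ 3 ≤ t ^ 2 := pow_le_pow_of_le_one ht0 ht1 (by norm_num)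
      nlinarith [sq_nonneg (n : ℝ)]
    have h4 : D₁ / t ^ 2 ≤ A * (n : ℝ) ^ 2 := by
      rw [div_le_iff₀ (by positivity)]
      nlinarith
    have h5 : n * τ / A ≤ n * (τ * D₂) := by
      have h6 : 1 / A ≤ D₂ := by rw [div_le_iff₀ hA]; rwa [div_le_iff₀ hD₂, mul_comm] at hA₂
      calc n * τ / A = n * τ * (1 / A) := by ring
        _ ≤ n * τ * D₂ := by gcongr
        _ = _ := by ring
    exact mul_le_mul h4 (Real.exp_le_exp.2 (by linarith)) (Real.exp_pos _).le (by positivity)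

end Concentration

/-! ### Almost sure rate by Borel–Cantelli -/

section AlmostSure

variable {Ω : Type*} [MeasurableSpace Ω] {P : Measure Ω}

theorem summable_ofReal_tail (A : ℝ) :
    ∑' n : ℕ, ENNReal.ofReal (A * (((n + 1 : ℕ) : ℝ) ^ 4)⁻¹) ≠ ⊤ := by
  have h1 : Summable fun n : ℕ => ((n : ℝ) ^ 4)⁻¹ := Real.summable_nat_pow_inv.2 (by norm_num)
  exact ((h1.comp_injective (add_left_injective 1)).mul_left A).tsum_ofReal_ne_top

/-- A tail bound of the form `A n² exp (-n t^(3/2) / A)` gives an almost sure rate. -/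
theorem ae_eventually_le_of_tail [IsProbabilityMeasure P] {A t₀ : ℝ} (hA : 0 < A) (ht₀ : 0 < t₀)
    {Z : ℕ → Ω → ℝ} (hZ : ∀ n : ℕ, 1 ≤ n → ∀ t, 0 ≤ t → t ≤ t₀ → P {ω | t < Z n ω} ≤
      ENNReal.ofReal (A * (n : ℝ) ^ 2 * Real.exp (-((n : ℝ) * t ^ (3 / 2 : ℝ) / A)))) :
    ∀ᵐ ω ∂P, ∀ᶠ n : ℕ in atTop, Z n ω ≤ (3 * (2 * A) * Real.log n / n) ^ (2 / 3 : ℝ) := by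
  set ε : ℕ → ℝ := fun n => (3 * (2 * A) * Real.log n / n) ^ (2 / 3 : ℝ) with hε
  have hlim : Tendsto ε atTop (𝓝 0) := by
    have h1 : Tendsto (fun n : ℕ => Real.log n / (n : ℝ)) atTop (𝓝 0) := by
      have := Real.isLittleO_log_id_atTop.tendsto_div_nhds_zero
      exact this.comp tendsto_natCast_atTop_atTop
    have h2 : Tendsto (fun n : ℕ => 3 * (2 * A) * Real.log n / (n : ℝ)) atTop (𝓝 0) := by
      have := h1.const_mul (3 * (2 * A))
      rw [mul_zero] at this
      exact this.congr fun n => by ring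
    have h3 := h2.rpow_const (p := (2 / 3 : ℝ)) (Or.inr (by norm_num))
    rwa [Real.zero_rpow (by norm_num)] at h3
  obtain ⟨N, hN⟩ := eventually_atTop.1 (hlim.eventually_le_const ht₀)
  have hbase : ∀ n : ℕ, 1 ≤ n → 0 ≤ 3 * (2 * A) * Real.log n / n := by
    intro n hn
    have : 0 ≤ Real.log n := Real.log_nonneg (by exact_mod_cast hn)
    positivity
  have hbound : ∀ n : ℕ, N ≤ n + 1 → P {ω | ε (n + 1) < Z (n + 1) ω} ≤
      ENNReal.ofReal (A * (((n + 1 : ℕ) : ℝ) ^ 4)⁻¹) := by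
    intro n hn
    have hn1 : 1 ≤ n + 1 := by omega
    have hpos : (0 : ℝ) < ((n + 1 : ℕ) : ℝ) := by positivity
    refine (hZ (n + 1) hn1 _ (Real.rpow_nonneg (hbase _ hn1) _) (hN _ hn)).trans
      (ENNReal.ofReal_le_ofReal (le_of_eq ?_))
    have hε1 : ε (n + 1) ^ (3 / 2 : ℝ) = 3 * (2 * A) * Real.log ((n + 1 : ℕ) : ℝ) / (n + 1 : ℕ) := by
      rw [hε]
      dsimp only
      rw [← Real.rpow_mul (hbase _ hn1), show (2 / 3 : ℝ) * (3 / 2) = 1 by norm_num, Real.rpow_one]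
    rw [hε1]
    generalize ((n + 1 : ℕ) : ℝ) = x at hpos
    -- The doubled constant makes the exponential `x ^ (-6)`, so the tail is of order `x ^ (-4)`.
    -- With `A` in place of `2 * A` it would be of order `1 / x`, which is not summable.
    have e : -(x * (3 * (2 * A) * Real.log x / x) / A) = Real.log ((x ^ 6)⁻¹) := by
      rw [Real.log_inv, Real.log_pow]
      field_simp
      push_cast
      ring
    rw [e, Real.exp_log (by positivity)]
    field_simp
  have hsum : ∑' n : ℕ, P {ω | N ≤ n + 1 ∧ ε (n + 1) < Z (n + 1) ω} ≠ ⊤ := by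
    refine ne_top_of_le_ne_top (summable_ofReal_tail A) (ENNReal.tsum_le_tsum fun n => ?_)
    by_cases hn : N ≤ n + 1
    · simpa [hn] using hbound n hn
    · simp [hn]
  filter_upwards [ae_eventually_notMem hsum] with ω hω
  obtain ⟨K, hK⟩ := eventually_atTop.1 hω
  refine eventually_atTop.2 ⟨max (K + 1) (max N 1), fun n hn => ?_⟩
  obtain ⟨k, rfl⟩ : ∃ k, n = k + 1 := ⟨n - 1, by omega⟩
  have := hK k (by omega)
  by_contra! hlt
  exact this ⟨by omega, hlt⟩

end AlmostSure

/-! ### Main theorem -/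

theorem theorem1 (r α : ℝ) (hα : 0 < α) (hαr : α < r) :
    ∃ t₀ : ℝ, 0 < t₀ ∧ ∀ d : ℝ, ∃ A : ℝ, 0 < A ∧
      ∀ S : Set Plane, IsCompact S → S.Nonempty →
        RollingCondition r S → RollingCondition r Sᶜ → Metric.diam S = d →
        -- the perimeter is positive and finite, so that the ratio below is meaningful
        (0 < hausdorffLength (frontier S) ∧ hausdorffLength (frontier S) < ⊤) ∧
        -- the tail bound for a sample of size `n`
        (∀ (Ω : Type u) [MeasurableSpace Ω] (P : Measure Ω) [IsProbabilityMeasure P]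
          (n : ℕ) (X : Fin n → Ω → Plane), 1 ≤ n → IsUniformSample P S X →
          ∀ t : ℝ, 0 ≤ t → t ≤ t₀ →
            P {ω | t < |(hausdorffLength (alphaShape α (range fun i => X i ω))).toReal /
                (hausdorffLength (frontier S)).toReal - 1|} ≤
              ENNReal.ofReal (A * (n : ℝ) ^ 2 * Real.exp (-((n : ℝ) * t ^ (3 / 2 : ℝ) / A)))) ∧
        -- the almost sure rate for the samples formed by the first `n` terms of a sequence
        (∀ (Ω : Type u) [MeasurableSpace Ω] (P : Measure Ω) [IsProbabilityMeasure P]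
          (X : ℕ → Ω → Plane), IsUniformSample P S X →
          ∀ᵐ ω ∂P, ∀ᶠ n : ℕ in atTop,
            (1 - (3 * A * Real.log n / n) ^ (2 / 3 : ℝ)) * (hausdorffLength (frontier S)).toReal ≤
                (hausdorffLength (alphaShape α (range fun i : Fin n => X i ω))).toReal ∧
              (hausdorffLength (alphaShape α (range fun i : Fin n => X i ω))).toReal ≤
                (1 + (3 * A * Real.log n / n) ^ (2 / 3 : ℝ)) *
                  (hausdorffLength (frontier S)).toReal) := by
  refine ⟨3 / 10000, by norm_num, fun d => ?_⟩
  set M := r / (r - α) with hM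
  -- A positive upper bound for the diameter, whatever the sign of `d`.
  set δ := |d| + 1 with hδ
  have hδ0 : 0 < δ := by positivity
  have hMpos : 0 < M := div_pos (hα.trans hαr) (by linarith)
  set D₁ := ((8 * (δ + α) + 3 * α) * (1200 * M ^ 3 / α)) ^ 2 with hD₁
  set D₂ := α ^ 2 / (128 * M ^ 5 * 300 ^ (3 / 2 : ℝ) * (Real.pi * δ ^ 2)) with hD₂
  have hD₂pos : 0 < D₂ := by have := Real.pi_pos; positivity
  set A := max 2 (max D₁ (1 / D₂)) with hA
  have hA2 : 2 ≤ A := le_max_left _ _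
  have hA₁ : D₁ ≤ A := (le_max_left _ _).trans (le_max_right _ _)
  have hA₂ : 1 / D₂ ≤ A := (le_max_right _ _).trans (le_max_right _ _)
  -- The tail bound holds with `A`; announcing `2 * A` gives Borel–Cantelli its summable margin.
  -- Hence `htail` is proved for every constant from `A` upwards.
  refine ⟨2 * A, by linarith, fun S hS hne h1 h2 hd => ?_⟩
  have hnorm : ∀ p ∈ frontier S, ∃ n, IsRollingNormal r S p n := fun p hp =>
    exists_isRollingNormal (hα.trans hαr) h1 h2 hp
  have hdδ : Metric.diam S ≤ δ := by rw [hd, hδ]; linarith [le_abs_self d]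
  have hlen := hausdorffMeasure_frontier_pos_lt_top hα hαr hS hne hnorm
  have htail : ∀ B, A ≤ B → ∀ (Ω : Type u) [MeasurableSpace Ω] (P : Measure Ω)
      [IsProbabilityMeasure P] (n : ℕ) (X : Fin n → Ω → Plane), 1 ≤ n → IsUniformSample P S X →
      ∀ t : ℝ, 0 ≤ t → t ≤ 3 / 10000 →
        P {ω | t < |(hausdorffLength (alphaShape α (range fun i => X i ω))).toReal /
            (hausdorffLength (frontier S)).toReal - 1|} ≤
          ENNReal.ofReal (B * (n : ℝ) ^ 2 * Real.exp (-((n : ℝ) * t ^ (3 / 2 : ℝ) / B))) := by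
    intro B hB Ω _ P _ n X hn hX t ht0 ht
    rw [← ENNReal.ofReal_toReal (measure_ne_top P _)]
    refine ENNReal.ofReal_le_ofReal (exp_tail_le hn ht0 (by linarith) hD₂pos (hA2.trans hB)
      (hA₁.trans hB) (hA₂.trans hB) ?_ fun htpos => ?_)
    · exact ENNReal.toReal_le_of_le_ofReal zero_le_one (by rw [ENNReal.ofReal_one]; exact prob_le_one)
    · exact ENNReal.toReal_le_of_le_ofReal (by positivity)
        (measure_length_ratio_le hα hαr hS hne hnorm hX hδ0 hdδ hM htpos ht)
  refine ⟨hlen, htail (2 * A) (by linarith), fun Ω _ P _ X hX => ?_⟩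
  have hZ := ae_eventually_le_of_tail (P := P) (A := A) (t₀ := 3 / 10000) (by linarith)
    (by norm_num) (Z := fun n ω =>
      |(hausdorffLength (alphaShape α (range fun i : Fin n => X i ω))).toReal /
        (hausdorffLength (frontier S)).toReal - 1|)
    fun n hn t ht0 ht => htail A le_rfl Ω P n (fun i => X i) hn
      ⟨fun i => hX.1 i, fun i => hX.2.1 i, hX.2.2.precomp Fin.val_injective⟩ t ht0 ht
  have hL : 0 < (hausdorffLength (frontier S)).toReal := ENNReal.toReal_pos hlen.1.ne' hlen.2.ne
  filter_upwards [hZ] with ω hω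
  filter_upwards [hω] with n hn
  rw [abs_le] at hn
  constructor
  · rw [← le_div_iff₀ hL]; linarith [hn.1]
  · rw [← div_le_iff₀ hL]; linarith [hn.2]
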